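/- Let $G$ be a locally compact (Hausdorff) group, $H$ a closed normal subgroup of $G$, and $\omega:G\to(0,\infty)$ a continuous weight, i.e. a continuous function with $\omega(xy)\le\omega(x)\omega(y)$ for all $x,y\in G$, which is bounded away from zero ($\omega\ge\delta$ for some $\delta>0$). Write $[x]=xH$, let $\hat\omega([x])=\inf_{z\in[x]}\omega(z)$, and fix (left, regular) Haar measures on $G$, $H$ and $G/H$. Let $L^1(G,\omega)$ be the Banach space of (classes of) measurable functions $f:G\to\mathbb C$ with $\|f\|_\omega=\int_G|f(x)|\,\omega(x)\,dx<\infty$, and define $L^1(G/H,\hat\omega)$ in the same way. (i) For every $f\in L^1(G,\omega)$ the integral $$(Tf)([x])=\int_H f(xh)\,dh$$ exists for almost every $[x]\in G/H$, and this defines a bounded linear operator $T:L^1(G,\omega)\to L^1(G/H,\hat\omega)$. Put $J_\omega(G,H)=\ker T$. (ii) There exist weighted Bruhat functions for $(H,\omega)$, that is, continuous functions $g:G\to[0,\infty)$ for which there is a constant $c>0$ with $$\int_H g(xh)\,dh=1\quad\text{and}\quad\int_H g(xh)\,\omega(xh)\,dh\le c\,\hat\omega([x])\qquad(x\in G).$$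 (iii) For every such function $g$, the formula $$(Pf)(x)=(Tf)([x])\,g(x)\qquad(x\in G,\ f\in L^1(G,\omega))$$ defines a bounded linear operator $P:L^1(G,\omega)\to L^1(G,\omega)$ with $P^2=P$ and $\ker P=J_\omega(G,H)$. (iv) Consequently $J_\omega(G,H)$ is complemented in the Banach space $L^1(G,\omega)$: it is the kernel, and also the range, of bounded projections on $L^1(G,\omega)$. -/

import Mathlib

open MeasureTheory Topology
open scoped ENNReal

noncomputable section

/-- A weight on a topological group: a positive, measurable, locally bounded,
submultiplicative real function. -/
structure IsWeight {G : Type*} [Group G] [TopologicalSpace G] [MeasurableSpace G]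
    (ω : G → ℝ) : Prop where
  pos : ∀ x, 0 < ω x
  measurable : Measurable ω
  locallyBounded : ∀ x, ∃ U ∈ 𝓝 x, BddAbove (ω '' U)
  submul : ∀ x y, ω (x * y) ≤ ω x * ω y

/-- The measure `ω dμ`. -/
abbrev weightedMeasure {X : Type*} [MeasurableSpace X] (μ : Measure X) (ω : X → ℝ) : Measure X :=
  μ.withDensity fun x => ENNReal.ofReal (ω x)

/-- `L¹(X, ω)`: classes of complex functions `f` with `∫ |f| ω dμ < ∞`, with the norm
`‖f‖ = ∫ |f| ω dμ`. For a positive measurable `ω`, the measures `ω dμ` and `μ` have the same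
null sets, so the equivalence relation is equality `μ`-almost everywhere. -/
abbrev WeightedL1 {X : Type*} [MeasurableSpace X] (μ : Measure X) (ω : X → ℝ) : Type _ :=
  Lp ℂ 1 (weightedMeasure μ ω)

/-- The induced weight on the quotient, `ω̂([x]) = inf {ω z | z ∈ [x]}`. -/
def quotientWeight {G : Type*} [Group G] (H : Subgroup G) (ω : G → ℝ) (q : G ⧸ H) : ℝ :=
  sInf (ω '' {z : G | (z : G ⧸ H) = q})

/-- Integration over the cosets of `H`: the function `[x] ↦ ∫_H f(xh) dh` on `G ⧸ H`. -/
def cosetIntegral {G : Type*} [Group G] [TopologicalSpace G] [IsTopologicalGroup G]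
    [MeasurableSpace G] [BorelSpace G] {H : Subgroup G} (η : Measure H) [η.IsMulLeftInvariant]
    (f : G → ℂ) : G ⧸ H → ℂ :=
  Quotient.lift (fun x : G => ∫ h : H, f (x * h) ∂η) (by
    intro a b hab
    have hab' : a⁻¹ * b ∈ H := QuotientGroup.leftRel_apply.mp hab
    have key := integral_mul_left_eq_self (μ := η) (fun h : H => f (a * h)) ⟨a⁻¹ * b, hab'⟩
    simpa [mul_assoc] using key.symm)

/-- Weighted Bruhat functions for `H` and `ω`: continuous `g ≥ 0` on `G` with
`∫_H g(xh) dh = 1` and `∫_H g(xh) ω(xh) dh ≤ c ω̂([x])` for all `x`, for some constant `c > 0`. -/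
structure IsWeightedBruhat {G : Type*} [Group G] [TopologicalSpace G] [MeasurableSpace G]
    {H : Subgroup G} (η : Measure H) (ω : G → ℝ) (g : G → ℝ) : Prop where
  continuous : Continuous g
  nonneg : ∀ x, 0 ≤ g x
  integral_eq_one : ∀ x : G, ∫ h : H, g (x * h) ∂η = 1
  integrable_mul : ∀ x : G, Integrable (fun h : H => g (x * h) * ω (x * h)) η
  integral_mul_le : ∃ c : ℝ, 0 < c ∧
    ∀ x : G, ∫ h : H, g (x * h) * ω (x * h) ∂η ≤ c * quotientWeight H ω (x : G ⧸ H)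

end

/-! Everything rests on Weil's formula `∫_G f = c ∫_{G/H} ∫_H f(xh) dh d[x]`, where `c` accounts for
the independent normalisations of the Haar measures. Since `ω̂([x]) ≤ ω(xh)`, it shows that `T` is
defined almost everywhere and bounded. A weighted Bruhat function `g` gives a bounded right inverse
`Sφ = (φ ∘ π) g`, where `π : G → G/H` is the quotient map: the bound on `∫_H g ω` makes `S` bounded,
and `∫_H g = 1` gives `TS = id`. Hence `P = ST` is idempotent with `ker P = ker T`, and `id - P`
projects onto this kernel.

To find `g`, choose in each coset a point where `ω` nearly attains its infimum. Submultiplicativity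
keeps `ω ≤ 2(ω(1) + 1) ω̂` on a neighbourhood of that point. Bump functions living there, divided by
their coset integrals, are glued by a partition of unity on the paracompact group `G/H`
(`exists_isWeightedBruhat`).

No σ-finiteness is assumed, so Weil's formula needs care. It passes from continuous functions to
open sets by `τ`-additivity (`lintegral_iSup_of_directed_lowerSemicontinuous`), then to measurable
functions by disintegration over countable unions of open sets of finite measure
(`exists_kernel_restrict_eq`). Integrable functions vanish off such a union; for pullbacks from
`G/H`, the factor `g` provides one. -/

/-! ### Suprema of directed families under a regular measure -/

/-- Regular measures are `τ`-additive on open sets. -/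
theorem measure_iUnion_of_directed_of_isOpen {X ι : Type*} [TopologicalSpace X]
    [MeasurableSpace X] [Nonempty ι] (ν : Measure X) [ν.Regular] {U : ι → Set X}
    (hU : ∀ i, IsOpen (U i)) (hd : Directed (· ⊆ ·) U) : ν (⋃ i, U i) = ⨆ i, ν (U i) := by
  refine le_antisymm ?_ (iSup_le fun i => measure_mono (Set.subset_iUnion U i))
  rw [(isOpen_iUnion hU).measure_eq_iSup_isCompact]
  refine iSup_le fun K => iSup_le fun hKU => iSup_le fun hK => ?_
  obtain ⟨i, hi⟩ := hK.elim_directed_cover U hU hKU hd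
  exact (measure_mono hi).trans (le_iSup (fun i => ν (U i)) i)

/-- Comparison of lower integrals through the measures of the superlevel sets. -/
theorem lintegral_le_lintegral_of_measure_lt_le {X : Type*} [MeasurableSpace X] {ν : Measure X}
    {f g : X → ℝ≥0∞} (hf : Measurable f) (hg : Measurable g)
    (h : ∀ t : ℝ≥0∞, ν {x | t < f x} ≤ ν {x | t < g x}) : ∫⁻ x, f x ∂ν ≤ ∫⁻ x, g x ∂ν := by
  -- The layer cake formula concerns real-valued functions, hence the cut-off at `n`, removed at the
  -- end by monotone convergence.
  have trunc : ∀ u : X → ℝ≥0∞, Measurable u → ∀ n : ℕ,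
      ∫⁻ x, min (u x) n ∂ν = ∫⁻ t in Set.Ioi (0 : ℝ), ν {x | t < (min (u x) n).toReal} := by
    intro u hu n
    rw [← lintegral_eq_lintegral_meas_lt ν (Filter.Eventually.of_forall fun x => by positivity)
      (hu.min measurable_const).ennreal_toReal.aemeasurable]
    refine lintegral_congr fun x => ?_
    rw [ENNReal.ofReal_toReal]
    exact ne_top_of_le_ne_top (ENNReal.natCast_ne_top n) (min_le_right _ _)
  have level : ∀ u : X → ℝ≥0∞, ∀ n : ℕ, ∀ t ∈ Set.Ioi (0 : ℝ),
      {x | t < (min (u x) n).toReal} = {x | ENNReal.ofReal t < u x} ∩ {_x | t < n} := by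
    intro u n t ht
    ext x
    have hne : min (u x) n ≠ ∞ :=
      ne_top_of_le_ne_top (ENNReal.natCast_ne_top n) (min_le_right _ _)
    have hn : ENNReal.ofReal t < n ↔ t < n := by
      rw [ENNReal.ofReal_lt_iff_lt_toReal (le_of_lt ht) (ENNReal.natCast_ne_top n)]
      simp
    simp only [Set.mem_ofPred_eq, Set.mem_inter_iff]
    rw [← ENNReal.ofReal_lt_iff_lt_toReal (le_of_lt ht) hne, lt_min_iff, hn]
  have sup : ∀ u : X → ℝ≥0∞, Measurable u → ∫⁻ x, u x ∂ν = ⨆ n : ℕ, ∫⁻ x, min (u x) n ∂ν := by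
    intro u hu
    rw [← lintegral_iSup (fun n => hu.min measurable_const)]
    · refine lintegral_congr fun x => ?_
      have : (⨆ n : ℕ, min (u x) n) = u x ⊓ ⨆ n : ℕ, (n : ℝ≥0∞) := (inf_iSup_eq _ _).symm
      rw [this, ENNReal.iSup_natCast, inf_top_eq]
    · intro m n hmn x
      exact min_le_min le_rfl (by exact_mod_cast hmn)
  rw [sup f hf, sup g hg]
  refine iSup_mono fun n => ?_
  rw [trunc f hf, trunc g hg]
  refine setLIntegral_mono' measurableSet_Ioi fun t ht => ?_
  rw [level f n t ht, level g n t ht]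
  by_cases htn : t < n
  · simpa [htn] using h _
  · simp [htn]

/-- `τ`-additivity of the integral of lower semicontinuous functions for a regular measure. -/
theorem lintegral_iSup_of_directed_lowerSemicontinuous {X ι : Type*} [TopologicalSpace X]
    [MeasurableSpace X] [BorelSpace X] [Nonempty ι] (ν : Measure X) [ν.Regular]
    {φ : ι → X → ℝ≥0∞} (hφ : ∀ i, LowerSemicontinuous (φ i)) (hd : Directed (· ≤ ·) φ) :
    ∫⁻ x, ⨆ i, φ i x ∂ν = ⨆ i, ∫⁻ x, φ i x ∂ν := by
  refine le_antisymm ?_ (iSup_le fun i => lintegral_mono fun x => le_iSup (fun i => φ i x) i)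
  have hlevel : ∀ t : ℝ≥0∞, ν {x | t < ⨆ i, φ i x} = ⨆ i, ν {x | t < φ i x} := by
    intro t
    rw [← measure_iUnion_of_directed_of_isOpen ν (U := fun i => {x | t < φ i x})
      fun i => (hφ i).isOpen_preimage t]
    · congr 1
      ext x
      simp [lt_iSup_iff]
    · intro i j
      obtain ⟨k, hik, hjk⟩ := hd i j
      exact ⟨k, fun x hx => lt_of_lt_of_le hx (hik x), fun x hx => lt_of_lt_of_le hx (hjk x)⟩
  -- An uncountable supremum is replaced by a sequence: at each rational level countably many
  -- indices already exhaust the measure of the superlevel set.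
  have hseq : ∀ r : ℚ, ∃ u : ℕ → ι,
      ⨆ n, ν {x | ENNReal.ofReal r < φ (u n) x} = ⨆ i, ν {x | ENNReal.ofReal r < φ i x} := by
    intro r
    obtain ⟨u, hu⟩ := exists_seq_tendsto_sSup
      (Set.range_nonempty fun i => ν {x | ENNReal.ofReal r < φ i x}) (OrderTop.bddAbove _)
    choose v hv using hu.2.2
    refine ⟨v, le_antisymm (iSup_le fun n => le_iSup (fun i => ν {x | _ < φ i x}) (v n)) ?_⟩
    rw [iSup]
    refine le_of_tendsto' hu.2.1 fun n => ?_
    rw [← hv n]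
    exact le_iSup (fun n => ν {x | ENNReal.ofReal r < φ (v n) x}) n
  choose u hu using hseq
  obtain ⟨e, he⟩ := exists_surjective_nat (ℚ × ℕ)
  choose k hk₁ hk₂ using hd
  -- Directedness merges the chosen sequences, enumerated by `e`, into one increasing sequence
  -- dominating every `φ (u r n)`.
  let v : ℕ → ι := fun n => Nat.rec (Classical.arbitrary ι)
    (fun n i => k i (u (e n).1 (e n).2)) n
  have hvs : ∀ n, v (n + 1) = k (v n) (u (e n).1 (e n).2) := fun n => rfl
  have hvm : Monotone fun n => φ (v n) := monotone_nat_of_le_succ fun n => by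
    rw [hvs]; exact hk₁ _ _
  have hmeas : ∀ i, Measurable (φ i) := fun i => (hφ i).measurable
  have key : ∫⁻ x, ⨆ i, φ i x ∂ν ≤ ∫⁻ x, ⨆ n, φ (v n) x ∂ν := by
    refine lintegral_le_lintegral_of_measure_lt_le
      (lowerSemicontinuous_iSup hφ).measurable (.iSup fun n => hmeas _) fun t => ?_
    -- Reduces an arbitrary level `t` to rational levels, where the sequences were chosen; the
    -- countable directed union then commutes with `ν`.
    have hcover : {x | t < ⨆ i, φ i x} =
        ⋃ r : {r : ℚ // t ≤ ENNReal.ofReal r}, {x | ENNReal.ofReal r < ⨆ i, φ i x} := by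
      ext x
      simp only [Set.mem_ofPred_eq, Set.mem_iUnion]
      constructor
      · intro hx
        obtain ⟨q, -, hq, hq'⟩ := ENNReal.lt_iff_exists_rat_btwn.1 hx
        exact ⟨⟨q, hq.le⟩, hq'⟩
      · rintro ⟨r, hr⟩
        exact lt_of_le_of_lt r.2 hr
    rw [hcover, Directed.measure_iUnion]
    · refine iSup_le fun r => ?_
      rw [hlevel, ← hu r]
      refine iSup_le fun n => measure_mono fun x hx => ?_
      obtain ⟨m, hm⟩ := he (r, n)
      have h1 : φ (u r n) x ≤ φ (v (m + 1)) x := by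
        rw [hvs, hm]; exact hk₂ _ _ x
      exact r.2.trans_lt (lt_of_lt_of_le hx (h1.trans (le_iSup (fun n => φ (v n) x) (m + 1))))
    · intro r s
      rcases le_total r.1 s.1 with hrs | hrs
      · exact ⟨r, subset_rfl, fun x hx => lt_of_le_of_lt
          (ENNReal.ofReal_le_ofReal (by exact_mod_cast hrs)) hx⟩
      · exact ⟨s, fun x hx => lt_of_le_of_lt
          (ENNReal.ofReal_le_ofReal (by exact_mod_cast hrs)) hx, subset_rfl⟩
  refine key.trans ?_
  rw [lintegral_iSup (fun n => hmeas _) hvm]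
  exact iSup_le fun n => le_iSup (fun i => ∫⁻ x, φ i x ∂ν) (v n)

/-! ### Approximating open sets by compactly supported continuous functions -/

section Urysohn

/-- The continuous compactly supported functions `0 ≤ f ≤ 1` with support in `U`. -/
abbrev UrysohnFunction {X : Type*} [TopologicalSpace X] (U : Set X) : Type _ :=
  {f : CompactlySupportedContinuousMap X ℝ // (∀ x, f x ∈ Set.Icc (0 : ℝ) 1) ∧ tsupport f ⊆ U}

variable {X : Type*} [TopologicalSpace X] {U : Set X}

theorem UrysohnFunction.exists_eq_one [R1Space X] [LocallyCompactSpace X] {K : Set X}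
    (hK : IsCompact K) (hU : IsOpen U) (hKU : K ⊆ U) :
    ∃ f : UrysohnFunction U, ∀ x ∈ K, f.1 x = 1 := by
  obtain ⟨f, hf1, hf2, hf3, hf4⟩ := exists_continuousMap_one_of_isCompact_subset_isOpen hK hU hKU
  exact ⟨⟨⟨f, hf2⟩, hf4, hf3⟩, fun x hx => hf1 hx⟩

/-- A cut-off equal to `1` on the union of the two compact supports dominates both functions. -/
theorem UrysohnFunction.directed [R1Space X] [LocallyCompactSpace X] (hU : IsOpen U)
    (f g : UrysohnFunction U) :
    ∃ h : UrysohnFunction U, (∀ x, f.1 x ≤ h.1 x) ∧ ∀ x, g.1 x ≤ h.1 x := by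
  obtain ⟨h, hh⟩ := exists_eq_one (K := tsupport f.1 ∪ tsupport g.1)
    (f.1.hasCompactSupport.isCompact.union g.1.hasCompactSupport.isCompact) hU
    (Set.union_subset f.2.2 g.2.2)
  have aux : ∀ k : UrysohnFunction U, tsupport k.1 ⊆ tsupport f.1 ∪ tsupport g.1 →
      ∀ x, k.1 x ≤ h.1 x := by
    intro k hk x
    by_cases hx : x ∈ tsupport k.1
    · rw [hh x (hk hx)]; exact (k.2.1 x).2
    · rw [image_eq_zero_of_notMem_tsupport hx]; exact (h.2.1 x).1
  exact ⟨h, aux f Set.subset_union_left, aux g Set.subset_union_right⟩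

/-- Inner regularity is required of `U` alone, so that the result serves both the Haar measure and
the coset measures. -/
theorem measure_eq_iSup_lintegral_urysohnFunction [R1Space X] [LocallyCompactSpace X]
    [MeasurableSpace X] [BorelSpace X] (m : Measure X) (hU : IsOpen U)
    (hm : m U ≤ ⨆ (K : Set X) (_ : K ⊆ U) (_ : IsCompact K), m K) :
    m U = ⨆ f : UrysohnFunction U, ∫⁻ x, ENNReal.ofReal (f.1 x) ∂m := by
  refine le_antisymm (hm.trans ?_) (iSup_le fun f => ?_)
  · refine iSup_le fun K => iSup_le fun hKU => iSup_le fun hK => ?_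
    obtain ⟨f, hf⟩ := UrysohnFunction.exists_eq_one hK hU hKU
    refine le_trans ?_ (le_iSup (fun f : UrysohnFunction U => ∫⁻ x, ENNReal.ofReal (f.1 x) ∂m) f)
    calc m K ≤ m {x | 1 ≤ ENNReal.ofReal (f.1 x)} :=
          measure_mono fun x hx => by simp [hf x hx]
      _ ≤ ∫⁻ x, ENNReal.ofReal (f.1 x) ∂m := by
          simpa using mul_meas_ge_le_lintegral (μ := m)
            f.1.continuous.measurable.ennreal_ofReal 1
  · rw [← lintegral_indicator_one hU.measurableSet]
    refine lintegral_mono fun x => ?_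
    by_cases hx : x ∈ U
    · simpa [hx] using (f.2.1 x).2
    · have : f.1 x = 0 := image_eq_zero_of_notMem_tsupport fun h => hx (f.2.2 h)
      simp [this]

end Urysohn

/-! ### Haar measure transported to the cosets of `H` -/

noncomputable section

variable {G : Type*} [Group G] [TopologicalSpace G] [IsTopologicalGroup G]
  [MeasurableSpace G] [BorelSpace G] {H : Subgroup G}

/-- The image of the Haar measure `η` of `H` on a coset of `H`, as a measure on `G`. -/
def cosetMeasure (η : Measure H) [η.IsMulLeftInvariant] : G ⧸ H → Measure G :=
  Quotient.lift (fun x : G => η.map fun h : H => x * h) (by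
    intro a b hab
    have hab' : a⁻¹ * b ∈ H := QuotientGroup.leftRel_apply.mp hab
    have hm : ∀ x : G, Measurable fun h : H => x * (h : G) := fun x =>
      (continuous_const.mul continuous_subtype_val).measurable
    conv_lhs => rw [← map_mul_left_eq_self η ⟨a⁻¹ * b, hab'⟩]
    rw [Measure.map_map (hm a) (measurable_const_mul _)]
    congr 1
    ext h
    simp [mul_assoc])

variable (η : Measure H) [η.IsMulLeftInvariant]

theorem cosetMeasure_mk (x : G) :
    cosetMeasure η (x : G ⧸ H) = η.map fun h : H => x * (h : G) := rfl

omit [MeasurableSpace G] [BorelSpace G] in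
theorem isClosedEmbedding_mul_coe (hH : IsClosed (H : Set G)) (x : G) :
    IsClosedEmbedding fun h : H => x * (h : G) :=
  (Homeomorph.mulLeft x).isClosedEmbedding.comp hH.isClosedEmbedding_subtypeVal

theorem measurableEmbedding_mul_coe (hH : IsClosed (H : Set G)) (x : G) :
    MeasurableEmbedding fun h : H => x * (h : G) :=
  (isClosedEmbedding_mul_coe hH x).measurableEmbedding

theorem lintegral_cosetMeasure_mk (hH : IsClosed (H : Set G)) (x : G) (F : G → ℝ≥0∞) :
    ∫⁻ y, F y ∂cosetMeasure η (x : G ⧸ H) = ∫⁻ h : H, F (x * h) ∂η := by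
  rw [cosetMeasure_mk, (measurableEmbedding_mul_coe hH x).lintegral_map]

theorem integral_cosetMeasure_mk (hH : IsClosed (H : Set G)) (x : G) {E : Type*}
    [NormedAddCommGroup E] [NormedSpace ℝ E] (f : G → E) :
    ∫ y, f y ∂cosetMeasure η (x : G ⧸ H) = ∫ h : H, f (x * h) ∂η := by
  rw [cosetMeasure_mk, (measurableEmbedding_mul_coe hH x).integral_map]

theorem integrable_cosetMeasure_mk_iff (hH : IsClosed (H : Set G)) (x : G) {E : Type*}
    [NormedAddCommGroup E] (f : G → E) :
    Integrable f (cosetMeasure η (x : G ⧸ H)) ↔ Integrable (fun h : H => f (x * h)) η := by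
  rw [cosetMeasure_mk, (measurableEmbedding_mul_coe hH x).integrable_map_iff]; rfl

theorem cosetIntegral_eq_integral_cosetMeasure (hH : IsClosed (H : Set G)) (f : G → ℂ)
    (q : G ⧸ H) : cosetIntegral η f q = ∫ y, f y ∂cosetMeasure η q := by
  induction q using QuotientGroup.induction_on with
  | H x => rw [integral_cosetMeasure_mk η hH]; rfl

theorem ae_cosetMeasure_mk_eq (hH : IsClosed (H : Set G)) (q : G ⧸ H) :
    ∀ᵐ y : G ∂cosetMeasure η q, (y : G ⧸ H) = q := by
  induction q using QuotientGroup.induction_on with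
  | H x =>
    rw [cosetMeasure_mk, (measurableEmbedding_mul_coe hH x).ae_map_iff]
    exact Filter.Eventually.of_forall fun h => by simp

theorem isFiniteMeasureOnCompacts_cosetMeasure [IsFiniteMeasureOnCompacts η]
    (hH : IsClosed (H : Set G)) (q : G ⧸ H) :
    IsFiniteMeasureOnCompacts (cosetMeasure η q) := by
  induction q using QuotientGroup.induction_on with
  | H x =>
    refine ⟨fun K hK => ?_⟩
    rw [cosetMeasure_mk, (measurableEmbedding_mul_coe hH x).map_apply]
    exact ((isClosedEmbedding_mul_coe hH x).isCompact_preimage hK).measure_lt_top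

theorem cosetMeasure_le_iSup_isCompact [η.Regular] (hH : IsClosed (H : Set G)) (q : G ⧸ H)
    {U : Set G} (hU : IsOpen U) :
    cosetMeasure η q U ≤ ⨆ (K : Set G) (_ : K ⊆ U) (_ : IsCompact K), cosetMeasure η q K := by
  induction q using QuotientGroup.induction_on with
  | H x =>
    have hemb := isClosedEmbedding_mul_coe hH x
    simp only [cosetMeasure_mk, hemb.measurableEmbedding.map_apply]
    rw [(hU.preimage hemb.continuous).measure_eq_iSup_isCompact]
    refine iSup_le fun K => iSup_le fun hKU => iSup_le fun hK => ?_
    refine le_iSup_of_le ((fun h : H => x * (h : G)) '' K) (le_iSup_of_le ?_ (le_iSup_of_le ?_ ?_))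
    · rintro - ⟨h, hh, rfl⟩; exact hKU hh
    · exact hK.image hemb.continuous
    · exact measure_mono (Set.subset_preimage_image _ _)

end

/-! ### Weil's formula for continuous functions and open sets -/

noncomputable section

variable {G : Type*} [Group G] [TopologicalSpace G] [IsTopologicalGroup G]
  [LocallyCompactSpace G] [MeasurableSpace G] [BorelSpace G] {H : Subgroup G}
  [H.Normal] (η : Measure H) [η.IsHaarMeasure]

/-- Coset integration is the pushforward along the exact sequence `H → G → G/H`, so its result is
continuous with compact support. -/
theorem integral_cosetMeasure_eq_pushforward (hH : IsClosed (H : Set G))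
    (f : CompactlySupportedContinuousMap G ℝ) (q : G ⧸ H) :
    ∫ y, f y ∂cosetMeasure η q =
      (TopologicalGroup.IsSES.ofClosedSubgroup H hH).pushforward η f q := by
  induction q using QuotientGroup.induction_on with
  | H x =>
    rw [integral_cosetMeasure_mk η hH]
    exact ((TopologicalGroup.IsSES.ofClosedSubgroup H hH).pushforward_apply_apply η f x).symm

theorem continuous_integral_cosetMeasure (hH : IsClosed (H : Set G)) {f : G → ℝ}
    (hf : Continuous f) (hfc : HasCompactSupport f) :
    Continuous fun q : G ⧸ H => ∫ y, f y ∂cosetMeasure η q := by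
  have := fun q => integral_cosetMeasure_eq_pushforward η hH ⟨⟨f, hf⟩, hfc⟩ q
  simp only [CompactlySupportedContinuousMap.coe_mk, ContinuousMap.coe_mk] at this
  simp only [this]
  exact ContinuousMapClass.map_continuous _


variable [T2Space G] [MeasurableSpace (G ⧸ H)] [BorelSpace (G ⧸ H)]

/-- Weil's formula for continuous functions of compact support. -/
theorem exists_integral_eq_mul_integral_cosetMeasure (hH : IsClosed (H : Set G))
    (μ : Measure G) [μ.IsHaarMeasure] [μ.Regular] (ν : Measure (G ⧸ H)) [ν.IsHaarMeasure] :
    ∃ c : NNReal, c ≠ 0 ∧ ∀ f : CompactlySupportedContinuousMap G ℝ,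
      ∫ x, f x ∂μ = c * ∫ q, ∫ y, f y ∂cosetMeasure η q ∂ν := by
  let hS := TopologicalGroup.IsSES.ofClosedSubgroup H hH
  refine ⟨Measure.haarScalarFactor μ (hS.inducedMeasure η ν),
    (Measure.haarScalarFactor_pos_of_isHaarMeasure _ _).ne', fun f => ?_⟩
  -- Uniqueness of Haar measure: the measure on `G` induced by `η` and `ν` is itself a Haar measure,
  -- so `μ` is a multiple of it.
  conv_lhs => rw [Measure.isMulLeftInvariant_eq_smul_of_regular μ (hS.inducedMeasure η ν)]
  rw [integral_smul_nnreal_measure, hS.integral_inducedMeasure, hS.integrate_apply]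
  simp only [integral_cosetMeasure_eq_pushforward η hH]
  rfl

variable [η.Regular]

omit [H.Normal] [T2Space G] [MeasurableSpace (G ⧸ H)] [BorelSpace (G ⧸ H)] in
theorem cosetMeasure_eq_iSup (hH : IsClosed (H : Set G)) {U : Set G} (hU : IsOpen U)
    (q : G ⧸ H) : cosetMeasure η q U =
      ⨆ f : UrysohnFunction U, ENNReal.ofReal (∫ y, f.1 y ∂cosetMeasure η q) := by
  have := isFiniteMeasureOnCompacts_cosetMeasure η hH q
  rw [measure_eq_iSup_lintegral_urysohnFunction _ hU (cosetMeasure_le_iSup_isCompact η hH q hU)]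
  refine iSup_congr fun f => ?_
  rw [ofReal_integral_eq_lintegral_ofReal f.1.integrable
    (Filter.Eventually.of_forall fun x => (f.2.1 x).1)]

-- A supremum of continuous functions, one for each Urysohn function of `U`.
omit [T2Space G] [MeasurableSpace (G ⧸ H)] [BorelSpace (G ⧸ H)] in
theorem lowerSemicontinuous_cosetMeasure (hH : IsClosed (H : Set G)) {U : Set G}
    (hU : IsOpen U) : LowerSemicontinuous fun q : G ⧸ H => cosetMeasure η q U := by
  simp only [cosetMeasure_eq_iSup η hH hU]
  exact lowerSemicontinuous_iSup fun f => (ENNReal.continuous_ofReal.comp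
    (continuous_integral_cosetMeasure η hH f.1.continuous f.1.hasCompactSupport)).lowerSemicontinuous

/-- Weil's formula for open sets. -/
theorem exists_measure_eq_mul_lintegral_cosetMeasure (hH : IsClosed (H : Set G))
    (μ : Measure G) [μ.IsHaarMeasure] [μ.Regular]
    (ν : Measure (G ⧸ H)) [ν.IsHaarMeasure] [ν.Regular] :
    ∃ c : NNReal, c ≠ 0 ∧ ∀ U : Set G, IsOpen U →
      μ U = c * ∫⁻ q, cosetMeasure η q U ∂ν := by
  obtain ⟨c, hc, hf⟩ := exists_integral_eq_mul_integral_cosetMeasure η hH μ ν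
  refine ⟨c, hc, fun U hU => ?_⟩
  have hfin := isFiniteMeasureOnCompacts_cosetMeasure η hH
  have hne : Nonempty (UrysohnFunction U) :=
    ⟨(UrysohnFunction.exists_eq_one isCompact_empty hU (Set.empty_subset U)).choose⟩
  have hcont := fun f : UrysohnFunction U =>
    continuous_integral_cosetMeasure η hH f.1.continuous f.1.hasCompactSupport
  rw [measure_eq_iSup_lintegral_urysohnFunction μ hU (hU.measure_eq_iSup_isCompact μ).le]
  simp only [cosetMeasure_eq_iSup η hH hU]
  -- The supremum over the uncountable family of Urysohn functions leaves the integral by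
  -- `τ`-additivity.
  rw [lintegral_iSup_of_directed_lowerSemicontinuous ν, ENNReal.mul_iSup]
  · refine iSup_congr fun f => ?_
    have hpos : ∀ q, 0 ≤ ∫ y, f.1 y ∂cosetMeasure η q :=
      fun q => integral_nonneg fun x => (f.2.1 x).1
    have hint : Integrable (fun q => ∫ y, f.1 y ∂cosetMeasure η q) ν := by
      simp only [integral_cosetMeasure_eq_pushforward η hH]
      exact CompactlySupportedContinuousMap.integrable _
    rw [← ofReal_integral_eq_lintegral_ofReal f.1.integrable
      (Filter.Eventually.of_forall fun x => (f.2.1 x).1), hf,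
      ← ofReal_integral_eq_lintegral_ofReal hint (Filter.Eventually.of_forall hpos),
      ENNReal.ofReal_mul c.coe_nonneg, ENNReal.ofReal_coe_nnreal]
  · exact fun f => (ENNReal.continuous_ofReal.comp (hcont f)).lowerSemicontinuous
  · intro f g
    obtain ⟨h, hfh, hgh⟩ := UrysohnFunction.directed hU f g
    refine ⟨h, fun q => ?_, fun q => ?_⟩ <;> have := hfin q
    · exact ENNReal.ofReal_le_ofReal (integral_mono f.1.integrable h.1.integrable hfh)
    · exact ENNReal.ofReal_le_ofReal (integral_mono g.1.integrable h.1.integrable hgh)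

end

/-! ### Disintegration over the cosets and Weil's formula for measurable functions -/

/-- The set `S` is covered by countably many open sets of finite measure. -/
def IsOpenSigmaFinite {X : Type*} [TopologicalSpace X] [MeasurableSpace X] (μ : Measure X)
    (S : Set X) : Prop :=
  ∃ U : ℕ → Set X, (∀ n, IsOpen (U n)) ∧ (∀ n, μ (U n) ≠ ∞) ∧ S ⊆ ⋃ n, U n

theorem IsOpenSigmaFinite.exists_monotone {X : Type*} [TopologicalSpace X] [MeasurableSpace X]
    {μ : Measure X} {S : Set X} (hS : IsOpenSigmaFinite μ S) :
    ∃ U : ℕ → Set X, (∀ n, IsOpen (U n)) ∧ (∀ n, μ (U n) ≠ ∞) ∧ Monotone U ∧ S ⊆ ⋃ n, U n := by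
  obtain ⟨U, ho, hf, hS⟩ := hS
  refine ⟨Set.accumulate U, fun n => ?_, fun n => ?_, Set.monotone_accumulate, ?_⟩
  · exact isOpen_biUnion fun i _ => ho i
  · exact (measure_biUnion_lt_top (Set.finite_Iic n) fun i _ => (hf i).lt_top).ne
  · rwa [Set.iUnion_accumulate]

/-- The sets `{F ≥ 1/(n+1)}` have finite measure by Markov's inequality, and outer regularity
encloses each in an open set of finite measure. -/
theorem isOpenSigmaFinite_support {X : Type*} [TopologicalSpace X] [MeasurableSpace X]
    {μ : Measure X} [μ.OuterRegular] {F : X → ℝ≥0∞} (hF : AEMeasurable F μ)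
    (hfin : ∫⁻ x, F x ∂μ ≠ ∞) : IsOpenSigmaFinite μ (Function.support F) := by
  have h1 : ∀ n : ℕ, μ {x | ((n : ℝ≥0∞) + 1)⁻¹ ≤ F x} < ∞ := fun n =>
    meas_ge_le_lintegral_div hF (by simp) (by simp) |>.trans_lt
      (ENNReal.div_lt_top hfin (by simp))
  choose U hU hUo hUf using fun n => Set.exists_isOpen_lt_of_lt _ _ (h1 n)
  refine ⟨U, hUo, fun n => (hUf n).ne, fun x hx => ?_⟩
  obtain ⟨n, hn⟩ := ENNReal.exists_inv_nat_lt (Function.mem_support.1 hx)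
  refine Set.mem_iUnion.2 ⟨n, hU n (le_trans ?_ hn.le)⟩
  exact ENNReal.inv_le_inv.2 le_self_add

noncomputable section

variable {G : Type*} [Group G] [TopologicalSpace G] [IsTopologicalGroup G]
  [LocallyCompactSpace G] [MeasurableSpace G] [BorelSpace G] {H : Subgroup G}
  [H.Normal] {η : Measure H} [η.IsHaarMeasure] [η.Regular]
  [MeasurableSpace (G ⧸ H)] [BorelSpace (G ⧸ H)] {μ : Measure G} {ν : Measure (G ⧸ H)}
  {c : NNReal}

theorem measurable_cosetMeasure_of_isOpen (hH : IsClosed (H : Set G)) {U : Set G}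
    (hU : IsOpen U) : Measurable fun q : G ⧸ H => cosetMeasure η q U :=
  (lowerSemicontinuous_cosetMeasure η hH hU).measurable

open ProbabilityTheory in
/-- Disintegration of `μ` along the cosets of `H`, over an open set of `σ`-finite measure. -/
theorem exists_kernel_restrict_eq (hH : IsClosed (H : Set G)) (hc : c ≠ 0)
    (hW : ∀ U : Set G, IsOpen U → μ U = c * ∫⁻ q, cosetMeasure η q U ∂ν)
    {U : ℕ → Set G} (hUo : ∀ n, IsOpen (U n)) (hUf : ∀ n, μ (U n) ≠ ∞) (hUm : Monotone U) :
    ∃ κ : Kernel (G ⧸ H) G,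
      (∀ᵐ q ∂ν, κ q = (cosetMeasure η q).restrict (⋃ n, U n)) ∧
      μ.restrict (⋃ n, U n) = c • (ν.bind κ) := by
  classical
  have hc' : (c : ℝ≥0∞) ≠ 0 := by simpa using hc
  -- Almost every coset gives finite mass to each `U n`. Setting the kernels to `0` on the other
  -- cosets makes them finite measures everywhere.
  let good : Set (G ⧸ H) := {q | ∀ n, cosetMeasure η q (U n) < ∞}
  have hgood : MeasurableSet good := by
    have : good = ⋂ n, {q | cosetMeasure η q (U n) < ∞} := by ext q; simp [good]
    rw [this]
    exact .iInter fun n => measurable_cosetMeasure_of_isOpen hH (hUo n) measurableSet_Iio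
  have hae : ∀ᵐ q ∂ν, q ∈ good := by
    refine ae_all_iff.2 fun n => ae_lt_top (measurable_cosetMeasure_of_isOpen hH (hUo n)) ?_
    intro h
    exact hUf n (by rw [hW _ (hUo n), h, ENNReal.mul_top hc'])
  let κn : ℕ → G ⧸ H → Measure G := fun n q =>
    if q ∈ good then (cosetMeasure η q).restrict (U n) else 0
  have hκn_fin : ∀ n q, IsFiniteMeasure (κn n q) := by
    intro n q
    by_cases hq : q ∈ good
    · simp only [κn, hq, if_true]
      exact ⟨by simpa using hq n⟩
    · simp only [κn, hq, if_false]; infer_instance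
  have hκn_open : ∀ n V, IsOpen V →
      (fun q => κn n q V) = good.indicator fun q => cosetMeasure η q (V ∩ U n) := by
    intro n V hV
    ext q
    by_cases hq : q ∈ good <;> simp [κn, hq, Measure.restrict_apply hV.measurableSet]
  have hκn_meas_open : ∀ n V, IsOpen V → Measurable fun q => κn n q V := by
    intro n V hV
    rw [hκn_open n V hV]
    exact (measurable_cosetMeasure_of_isOpen hH (hV.inter (hUo n))).indicator hgood
  -- For finite measures it suffices to test measurability on the `π`-system of open sets.
  have hκn : ∀ n, Measurable (κn n) := fun n =>
    Measurable.measure_of_isPiSystem (S := {s | IsOpen s}) (BorelSpace.measurable_eq)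
      isPiSystem_isOpen (hκn_meas_open n) (hκn_meas_open n _ isOpen_univ)
  let κ₀ : G ⧸ H → Measure G := fun q =>
    if q ∈ good then (cosetMeasure η q).restrict (⋃ n, U n) else 0
  have hκ_sup : ∀ A, MeasurableSet A → ∀ q, κ₀ q A = ⨆ n, κn n q A := by
    intro A hA q
    by_cases hq : q ∈ good
    · simp only [κ₀, κn, hq, if_true]
      exact Measure.restrict_iUnion_apply_eq_iSup hUm.directed_le hA
    · simp [κ₀, κn, hq]
  have hκ : Measurable κ₀ := by
    refine Measure.measurable_measure.2 fun A hA => ?_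
    simp only [hκ_sup A hA]
    exact .iSup fun n => Measure.measurable_measure.1 (hκn n) A hA
  refine ⟨⟨κ₀, hκ⟩, ?_, ?_⟩
  · filter_upwards [hae] with q hq
    simp [κ₀, hq]
  have hn : ∀ n, μ.restrict (U n) = c • (ν.bind (κn n)) := by
    intro n
    have : IsFiniteMeasure (μ.restrict (U n)) := ⟨by simpa using (hUf n).lt_top⟩
    have hV : ∀ V, IsOpen V → μ.restrict (U n) V = (c • (ν.bind (κn n))) V := by
      intro V hV
      rw [Measure.restrict_apply hV.measurableSet, hW _ (hV.inter (hUo n)), Measure.smul_apply,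
        Measure.bind_apply hV.measurableSet (hκn n).aemeasurable, ENNReal.smul_def, smul_eq_mul]
      congr 1
      refine lintegral_congr_ae ?_
      filter_upwards [hae] with q hq
      rw [congrFun (hκn_open n V hV) q, Set.indicator_of_mem hq]
    exact ext_of_generate_finite {s | IsOpen s} BorelSpace.measurable_eq isPiSystem_isOpen
      hV (hV _ isOpen_univ)
  ext A hA
  rw [Measure.restrict_iUnion_apply_eq_iSup hUm.directed_le hA, Measure.smul_apply,
    Kernel.coe_mk,
    Measure.bind_apply hA hκ.aemeasurable]
  simp only [hκ_sup A hA]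
  rw [lintegral_iSup (fun n => Measure.measurable_measure.1 (hκn n) A hA),
    ENNReal.smul_def, smul_eq_mul, ENNReal.mul_iSup]
  · refine iSup_congr fun n => ?_
    rw [hn, Measure.smul_apply, Measure.bind_apply hA (hκn n).aemeasurable, ENNReal.smul_def,
      smul_eq_mul]
  · intro m n hmn q
    by_cases hq : q ∈ good
    · simp only [κn, hq, if_true]
      exact Measure.restrict_mono (hUm hmn) le_rfl A
    · simp [κn, hq]

/-- Weil's formula for nonnegative functions with support of `σ`-finite measure. -/
theorem lintegral_eq_mul_lintegral_cosetMeasure_of_support (hH : IsClosed (H : Set G))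
    (hc : c ≠ 0) (hW : ∀ U : Set G, IsOpen U → μ U = c * ∫⁻ q, cosetMeasure η q U ∂ν)
    {F : G → ℝ≥0∞} (hF : AEMeasurable F μ) (hS : IsOpenSigmaFinite μ (Function.support F)) :
    AEMeasurable (fun q => ∫⁻ y, F y ∂cosetMeasure η q) ν ∧
      ∫⁻ x, F x ∂μ = c * ∫⁻ q, ∫⁻ y, F y ∂cosetMeasure η q ∂ν := by
  obtain ⟨U, hUo, hUf, hUm, hU⟩ := hS.exists_monotone
  obtain ⟨κ, hκ, hμ⟩ := exists_kernel_restrict_eq hH hc hW hUo hUf hUm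
  have hS : MeasurableSet (⋃ n, U n) := (isOpen_iUnion hUo).measurableSet
  have hae : (fun q => ∫⁻ y, F y ∂κ q) =ᵐ[ν] fun q => ∫⁻ y, F y ∂cosetMeasure η q := by
    filter_upwards [hκ] with q hq
    rw [hq, setLIntegral_eq_of_support_subset hU]
  have hc' : (c : ℝ≥0∞) ≠ 0 := by simpa using hc
  have hF' : AEMeasurable F (ν.bind κ) := by
    have h1 : AEMeasurable F (c • (ν.bind κ)) := hμ ▸ hF.restrict
    exact h1.mono_ac (Measure.absolutelyContinuous_smul hc')
  refine ⟨?_, ?_⟩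
  · have h2 : AEMeasurable (fun q => ∫⁻ y, hF'.mk F y ∂κ q) ν :=
      (hF'.measurable_mk.lintegral_kernel).aemeasurable
    refine h2.congr (Filter.EventuallyEq.trans ?_ hae)
    filter_upwards [Measure.ae_ae_of_ae_bind κ.aemeasurable hF'.ae_eq_mk] with q hq
    exact lintegral_congr_ae (Filter.EventuallyEq.symm hq)
  · rw [← setLIntegral_eq_of_support_subset hU, hμ, lintegral_smul_measure,
      Measure.lintegral_bind κ.aemeasurable hF', lintegral_congr_ae hae]
    rfl

/-- Weil's formula for nonnegative functions. -/
theorem lintegral_eq_mul_lintegral_cosetMeasure [μ.OuterRegular] (hH : IsClosed (H : Set G))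
    (hc : c ≠ 0) (hW : ∀ U : Set G, IsOpen U → μ U = c * ∫⁻ q, cosetMeasure η q U ∂ν)
    {F : G → ℝ≥0∞} (hF : AEMeasurable F μ) (hfin : ∫⁻ x, F x ∂μ ≠ ∞) :
    AEMeasurable (fun q => ∫⁻ y, F y ∂cosetMeasure η q) ν ∧
      ∫⁻ x, F x ∂μ = c * ∫⁻ q, ∫⁻ y, F y ∂cosetMeasure η q ∂ν :=
  lintegral_eq_mul_lintegral_cosetMeasure_of_support hH hc hW hF
    (isOpenSigmaFinite_support hF hfin)

/-- Weil's formula for the indicator of a measurable null hull of the exceptional set. -/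
theorem ae_ae_cosetMeasure_of_ae [μ.OuterRegular] (hH : IsClosed (H : Set G))
    (hc : c ≠ 0) (hW : ∀ U : Set G, IsOpen U → μ U = c * ∫⁻ q, cosetMeasure η q U ∂ν)
    {p : G → Prop} (hp : ∀ᵐ x ∂μ, p x) : ∀ᵐ q ∂ν, ∀ᵐ y ∂cosetMeasure η q, p y := by
  let N := toMeasurable μ {x | ¬ p x}
  have hN : MeasurableSet N := measurableSet_toMeasurable _ _
  have h0 : ∫⁻ x, N.indicator 1 x ∂μ = 0 := by
    rw [lintegral_indicator_one hN, measure_toMeasurable]; exact hp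
  obtain ⟨hm, he⟩ := lintegral_eq_mul_lintegral_cosetMeasure hH hc hW
    (F := N.indicator 1) ((measurable_const.indicator hN).aemeasurable) (by simp [h0])
  rw [h0, eq_comm, mul_eq_zero, or_iff_right (by simpa using hc), lintegral_eq_zero_iff' hm] at he
  filter_upwards [he] with q hq
  rw [lintegral_indicator_one hN, Pi.zero_apply] at hq
  exact measure_mono_null (subset_toMeasurable _ _) hq

/-- An integrable `f` vanishes off a union of countably many open sets of finite measure, and there
the coset measures form a kernel to which Fubini-type results apply. -/
theorem integrable_cosetMeasure [μ.OuterRegular] (hH : IsClosed (H : Set G))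
    (hc : c ≠ 0) (hW : ∀ U : Set G, IsOpen U → μ U = c * ∫⁻ q, cosetMeasure η q U ∂ν)
    {E : Type*} [NormedAddCommGroup E] [NormedSpace ℝ E] {f : G → E} (hf : Integrable f μ) :
    (∀ᵐ q ∂ν, Integrable f (cosetMeasure η q)) ∧
      AEStronglyMeasurable (fun q => ∫ y, f y ∂cosetMeasure η q) ν := by
  obtain ⟨U, hUo, hUf, hUm, hU⟩ :=
    (isOpenSigmaFinite_support hf.1.enorm hf.2.ne).exists_monotone
  obtain ⟨κ, hκ, hμ⟩ := exists_kernel_restrict_eq hH hc hW hUo hUf hUm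
  have hU' : Function.support f ⊆ ⋃ n, U n := fun x hx => hU (by simpa using hx)
  have hf' : Integrable f (ν.bind κ) := by
    have h1 : Integrable f (c • (ν.bind κ)) := hμ ▸ hf.restrict
    exact (integrable_smul_measure (c := (c : ℝ≥0∞)) (by simpa using hc) (by simp)).1 h1
  constructor
  · filter_upwards [hκ, ((Measure.integrable_comp_iff hf'.1).1 hf').1] with q hq hi
    rw [hq] at hi
    exact (integrableOn_iff_integrable_of_support_subset hU').1 hi
  · have h2 : AEStronglyMeasurable (fun q => ∫ y, hf'.1.mk f y ∂κ q) ν :=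
      (hf'.1.stronglyMeasurable_mk.integral_kernel).aestronglyMeasurable
    refine h2.congr ?_
    filter_upwards [hκ, Measure.ae_ae_of_ae_bind κ.aemeasurable hf'.1.ae_eq_mk] with q hq hi
    rw [integral_congr_ae (Filter.EventuallyEq.symm hi), hq, setIntegral_eq_integral_of_forall_compl_eq_zero]
    intro x hx
    by_contra h
    exact hx (hU' h)

end

/-! ### Weighted `L¹` spaces and operators between them -/

section WeightedMeasure

variable {X : Type*} [MeasurableSpace X] {μ : Measure X} {w : X → ℝ}

theorem ae_weightedMeasure_eq (hw : Measurable w) (hpos : ∀ x, 0 < w x) :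
    ae (weightedMeasure μ w) = ae μ := by
  ext s
  have := ae_withDensity_iff (μ := μ) (p := (· ∈ s)) hw.ennreal_ofReal
  simpa [hpos, Filter.Eventually] using this

theorem aestronglyMeasurable_weightedMeasure_iff (hw : Measurable w) (hpos : ∀ x, 0 < w x)
    {f : X → ℂ} : AEStronglyMeasurable f (weightedMeasure μ w) ↔ AEStronglyMeasurable f μ := by
  constructor <;> intro h
  · refine h.mono_ac ?_
    rw [← Measure.ae_le_iff_absolutelyContinuous, ae_weightedMeasure_eq hw hpos]
  · exact h.mono_ac (withDensity_absolutelyContinuous _ _)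

theorem eLpNorm_one_weightedMeasure (hw : Measurable w) (f : X → ℂ) :
    eLpNorm f 1 (weightedMeasure μ w) = ∫⁻ x, ENNReal.ofReal (w x) * ‖f x‖ₑ ∂μ := by
  rw [eLpNorm_one_eq_lintegral_enorm, lintegral_withDensity_eq_lintegral_mul_non_measurable _
    hw.ennreal_ofReal (Filter.Eventually.of_forall fun x => ENNReal.ofReal_lt_top)]
  rfl

theorem integrable_of_memLp_weightedMeasure (hw : Measurable w) {δ : ℝ} (hδ : 0 < δ)
    (hδw : ∀ x, δ ≤ w x) {f : X → ℂ} (hf : MemLp f 1 (weightedMeasure μ w)) :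
    Integrable f μ := by
  refine ⟨(aestronglyMeasurable_weightedMeasure_iff hw fun x => hδ.trans_le (hδw x)).1 hf.1, ?_⟩
  have h := hf.2
  rw [eLpNorm_one_weightedMeasure hw] at h
  have h1 : ENNReal.ofReal δ * ∫⁻ x, ‖f x‖ₑ ∂μ < ∞ := by
    rw [← lintegral_const_mul' _ _ ENNReal.ofReal_ne_top]
    refine lt_of_le_of_lt (lintegral_mono fun x => ?_) h
    gcongr
    exact hδw x
  exact (ENNReal.mul_lt_top_iff.1 h1).elim (fun h => h.2) fun h => h.elim
    (fun h => absurd h (by simpa using hδ)) fun h => by simp [HasFiniteIntegral, h]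

end WeightedMeasure

/-- A bounded linear operator between `L¹` spaces defined on representatives. -/
theorem exists_continuousLinearMap_of_representatives {X Y : Type*} [MeasurableSpace X]
    [MeasurableSpace Y] {μ : Measure X} {ν : Measure Y} (Φ : (X → ℂ) → Y → ℂ) (C : NNReal)
    (hmeas : ∀ f, MemLp f 1 μ → AEStronglyMeasurable (Φ f) ν)
    (hbound : ∀ f, MemLp f 1 μ → eLpNorm (Φ f) 1 ν ≤ C * eLpNorm f 1 μ)
    (hcongr : ∀ f g, f =ᵐ[μ] g → Φ f =ᵐ[ν] Φ g)
    (hadd : ∀ f g, MemLp f 1 μ → MemLp g 1 μ → Φ (f + g) =ᵐ[ν] Φ f + Φ g)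
    (hsmul : ∀ (a : ℂ) f, Φ (a • f) =ᵐ[ν] a • Φ f) :
    ∃ T : Lp ℂ 1 μ →L[ℂ] Lp ℂ 1 ν, ∀ (f : X → ℂ) (hf : MemLp f 1 μ),
      T (hf.toLp f) =ᵐ[ν] Φ f := by
  have hmem : ∀ f, MemLp f 1 μ → MemLp (Φ f) 1 ν := fun f hf =>
    ⟨hmeas f hf, (hbound f hf).trans_lt (ENNReal.mul_lt_top ENNReal.coe_lt_top hf.2)⟩
  let T₀ : Lp ℂ 1 μ →ₗ[ℂ] Lp ℂ 1 ν :=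
    { toFun := fun f => (hmem f (Lp.memLp f)).toLp (Φ f)
      map_add' := fun f g => by
        rw [← MemLp.toLp_add, MemLp.toLp_eq_toLp_iff]
        exact (hcongr _ _ (Lp.coeFn_add f g)).trans (hadd _ _ (Lp.memLp f) (Lp.memLp g))
      map_smul' := fun a f => by
        rw [RingHom.id_apply, ← MemLp.toLp_const_smul, MemLp.toLp_eq_toLp_iff]
        exact (hcongr _ _ (Lp.coeFn_smul a f)).trans (hsmul a _) }
  refine ⟨T₀.mkContinuous C fun f => ?_, fun f hf => ?_⟩
  · change ‖(hmem f (Lp.memLp f)).toLp (Φ f)‖ ≤ _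
    rw [Lp.norm_toLp, Lp.norm_def, ← ENNReal.coe_toReal, ← ENNReal.toReal_mul]
    exact ENNReal.toReal_mono (ENNReal.mul_ne_top ENNReal.coe_ne_top (Lp.eLpNorm_ne_top f))
      (hbound f (Lp.memLp f))
  · exact ((hmem _ (Lp.memLp _)).coeFn_toLp).trans (hcongr _ _ hf.coeFn_toLp)

/-! ### The induced weight on the quotient -/

section QuotientWeight

variable {G : Type*} [Group G] {H : Subgroup G} {ω : G → ℝ}

theorem quotientWeight_le (hpos : ∀ x, 0 < ω x) (x : G) :
    quotientWeight H ω (x : G ⧸ H) ≤ ω x :=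
  csInf_le ⟨0, by rintro - ⟨z, -, rfl⟩; exact (hpos z).le⟩ ⟨x, rfl, rfl⟩

theorem le_quotientWeight {δ : ℝ} (x : G) (h : ∀ z : G, (z : G ⧸ H) = x → δ ≤ ω z) :
    δ ≤ quotientWeight H ω (x : G ⧸ H) :=
  le_csInf ⟨_, x, rfl, rfl⟩ (by rintro - ⟨z, hz, rfl⟩; exact h z hz)

theorem le_quotientWeight_of_forall {δ : ℝ} (h : ∀ z, δ ≤ ω z) (q : G ⧸ H) :
    δ ≤ quotientWeight H ω q := by
  induction q using QuotientGroup.induction_on with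
  | H x => exact le_quotientWeight x fun z _ => h z

theorem exists_lt_of_quotientWeight_lt (x : G) {t : ℝ}
    (h : quotientWeight H ω (x : G ⧸ H) < t) : ∃ z : G, (z : G ⧸ H) = x ∧ ω z < t := by
  obtain ⟨-, ⟨z, hz, rfl⟩, hlt⟩ := exists_lt_of_csInf_lt
    (s := ω '' {z : G | (z : G ⧸ H) = x}) ⟨_, x, rfl, rfl⟩ h
  exact ⟨z, hz, hlt⟩

/-- The set `{ω̂ < t}` is the image of `{ω < t}` under the open quotient map. This supplies the
measurability of `ω̂`. -/
theorem upperSemicontinuous_quotientWeight [TopologicalSpace G] [IsTopologicalGroup G]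
    (hω : Continuous ω) (hpos : ∀ x, 0 < ω x) :
    UpperSemicontinuous (quotientWeight H ω) := by
  refine upperSemicontinuous_iff_isOpen_preimage.2 fun t => ?_
  have : quotientWeight H ω ⁻¹' Set.Iio t = ((↑) : G → G ⧸ H) '' (ω ⁻¹' Set.Iio t) := by
    ext q
    induction q using QuotientGroup.induction_on with
    | H x =>
      constructor
      · intro h
        obtain ⟨z, hz, hlt⟩ := exists_lt_of_quotientWeight_lt x h
        exact ⟨z, hlt, hz⟩
      · rintro ⟨z, hz, hzx⟩
        rw [← hzx]
        exact (quotientWeight_le hpos z).trans_lt hz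
  rw [this]
  exact QuotientGroup.isOpenMap_coe _ (isOpen_Iio.preimage hω)

end QuotientWeight

/-! ### Coset integration and its right inverse -/

noncomputable section

variable {G : Type*} [Group G] [TopologicalSpace G] [IsTopologicalGroup G]
  [LocallyCompactSpace G] [MeasurableSpace G] [BorelSpace G] {H : Subgroup G}
  [H.Normal] {η : Measure H} [η.IsHaarMeasure] [η.Regular]
  [MeasurableSpace (G ⧸ H)] [BorelSpace (G ⧸ H)] {μ : Measure G} {ν : Measure (G ⧸ H)}
  {c : NNReal} {ω g : G → ℝ}

/-- Integration over the cosets of `H` as an operator from `L¹(G, ω)` to `L¹(G ⧸ H, ω̂)`. -/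
theorem exists_cosetIntegral_continuousLinearMap [μ.OuterRegular] (hH : IsClosed (H : Set G))
    (hc : c ≠ 0) (hW : ∀ U : Set G, IsOpen U → μ U = c * ∫⁻ q, cosetMeasure η q U ∂ν)
    (hω : Continuous ω) {δ : ℝ} (hδ : 0 < δ) (hδω : ∀ x, δ ≤ ω x) :
    ∃ T : WeightedL1 μ ω →L[ℂ] WeightedL1 ν (quotientWeight H ω),
      ∀ (f : G → ℂ) (hf : MemLp f 1 (weightedMeasure μ ω)),
        (∀ᵐ q ∂ν, Integrable f (cosetMeasure η q)) ∧
        T (hf.toLp f) =ᵐ[ν] cosetIntegral η f := by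
  have hpos : ∀ x, 0 < ω x := fun x => hδ.trans_le (hδω x)
  have hpos' : ∀ q, 0 < quotientWeight H ω q := fun q =>
    hδ.trans_le (le_quotientWeight_of_forall hδω q)
  have hmω : Measurable ω := hω.measurable
  have hmω' : Measurable (quotientWeight H ω) :=
    (upperSemicontinuous_quotientWeight hω hpos).measurable
  have haeG := ae_weightedMeasure_eq (μ := μ) hmω hpos
  have haeQ := ae_weightedMeasure_eq (μ := ν) hmω' hpos'
  have hint : ∀ f, MemLp f 1 (weightedMeasure μ ω) → Integrable f μ := fun f hf =>
    integrable_of_memLp_weightedMeasure hmω hδ hδω hf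
  have hcos := fun f : G → ℂ => funext (cosetIntegral_eq_integral_cosetMeasure η hH f)
  -- The bound `c⁻¹` cancels the constant of Weil's formula.
  have hT := exists_continuousLinearMap_of_representatives (μ := weightedMeasure μ ω)
    (ν := weightedMeasure ν (quotientWeight H ω)) (cosetIntegral η) c⁻¹ ?_ ?_ ?_ ?_ ?_
  · obtain ⟨T, hT⟩ := hT
    refine ⟨T, fun f hf => ⟨(integrable_cosetMeasure hH hc hW (hint f hf)).1, ?_⟩⟩
    have := hT f hf
    rwa [Filter.EventuallyEq, haeQ] at this
  · intro f hf
    rw [aestronglyMeasurable_weightedMeasure_iff hmω' hpos', hcos]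
    exact (integrable_cosetMeasure hH hc hW (hint f hf)).2
  · intro f hf
    rw [eLpNorm_one_weightedMeasure hmω', eLpNorm_one_weightedMeasure hmω, hcos]
    have hF : AEMeasurable (fun x => ENNReal.ofReal (ω x) * ‖f x‖ₑ) μ :=
      hmω.ennreal_ofReal.aemeasurable.mul (hint f hf).1.enorm
    have hfin : ∫⁻ x, ENNReal.ofReal (ω x) * ‖f x‖ₑ ∂μ ≠ ∞ := by
      rw [← eLpNorm_one_weightedMeasure hmω]; exact hf.2.ne
    rw [(lintegral_eq_mul_lintegral_cosetMeasure hH hc hW hF hfin).2, ← mul_assoc,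
      ← ENNReal.coe_mul, inv_mul_cancel₀ hc, ENNReal.coe_one, one_mul]
    refine lintegral_mono fun q => ?_
    calc ENNReal.ofReal (quotientWeight H ω q) * ‖∫ y, f y ∂cosetMeasure η q‖ₑ
        ≤ ENNReal.ofReal (quotientWeight H ω q) * ∫⁻ y, ‖f y‖ₑ ∂cosetMeasure η q := by
          gcongr; exact enorm_integral_le_lintegral_enorm _
      _ = ∫⁻ y, ENNReal.ofReal (quotientWeight H ω q) * ‖f y‖ₑ ∂cosetMeasure η q :=
          (lintegral_const_mul' _ _ ENNReal.ofReal_ne_top).symm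
      _ ≤ ∫⁻ y, ENNReal.ofReal (ω y) * ‖f y‖ₑ ∂cosetMeasure η q := by
          refine lintegral_mono_ae ?_
          filter_upwards [ae_cosetMeasure_mk_eq η hH q] with y hy
          gcongr
          rw [← hy]
          exact quotientWeight_le hpos y
  · intro f f' hff'
    rw [Filter.EventuallyEq, haeG] at hff'
    rw [Filter.EventuallyEq, haeQ, hcos, hcos]
    filter_upwards [ae_ae_cosetMeasure_of_ae hH hc hW hff'] with q hq
    exact integral_congr_ae hq
  · intro f f' hf hf'
    rw [Filter.EventuallyEq, haeQ, hcos, hcos, hcos]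
    filter_upwards [(integrable_cosetMeasure hH hc hW (hint f hf)).1,
      (integrable_cosetMeasure hH hc hW (hint f' hf')).1] with q hq hq'
    exact integral_add hq hq'
  · intro a f
    refine Filter.Eventually.of_forall fun q => ?_
    simp only [hcos, Pi.smul_apply]
    exact integral_smul a f

-- The full preimage of a σ-finite set can fail to be σ-finite, as `H` itself may be too large.
-- Intersecting with `{g > 1/(n+1)}` cures this: since `∫ g = 1` on each coset, that set has coset
-- measure at most `n + 1`.
omit [LocallyCompactSpace G] [H.Normal] [η.Regular] in
theorem isOpenSigmaFinite_preimage_inter_support [ν.OuterRegular] (hH : IsClosed (H : Set G))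
    (hW : ∀ U : Set G, IsOpen U → μ U = c * ∫⁻ q, cosetMeasure η q U ∂ν)
    (hg : Continuous g) (hg0 : ∀ x, 0 ≤ g x)
    (hg1 : ∀ q, ∫⁻ y, ENNReal.ofReal (g y) ∂cosetMeasure η q = 1)
    {S : Set (G ⧸ H)} (hS : IsOpenSigmaFinite ν S) :
    IsOpenSigmaFinite μ (((↑) : G → G ⧸ H) ⁻¹' S ∩ Function.support g) := by
  obtain ⟨V, hVo, hVf, hVm, hV⟩ := hS.exists_monotone
  have hcont : Continuous ((↑) : G → G ⧸ H) := QuotientGroup.continuous_mk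
  let U : ℕ → Set G := fun n => ((↑) : G → G ⧸ H) ⁻¹' (V n) ∩ {x | ((n : ℝ) + 1)⁻¹ < g x}
  have hUo : ∀ n, IsOpen (U n) := fun n =>
    ((hVo n).preimage hcont).inter (isOpen_lt continuous_const hg)
  refine ⟨U, hUo, fun n => ?_, ?_⟩
  · rw [hW _ (hUo n)]
    refine ENNReal.mul_ne_top ENNReal.coe_ne_top (ne_top_of_le_ne_top
      (ENNReal.mul_ne_top (a := (n : ℝ≥0∞) + 1) (by simp) (hVf n)) ?_)
    rw [← lintegral_indicator_const (hVo n).measurableSet]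
    refine lintegral_mono fun q => ?_
    by_cases hq : q ∈ V n
    · rw [Set.indicator_of_mem hq]
      have hε : ENNReal.ofReal ((n : ℝ) + 1)⁻¹ = ((n : ℝ≥0∞) + 1)⁻¹ := by
        rw [ENNReal.ofReal_inv_of_pos (by positivity), ENNReal.ofReal_add (by positivity) (by simp)]
        simp
      have := mul_meas_ge_le_lintegral (μ := cosetMeasure η q) hg.measurable.ennreal_ofReal
        ((n : ℝ≥0∞) + 1)⁻¹
      rw [hg1] at this
      calc cosetMeasure η q (U n)
          ≤ cosetMeasure η q {x | ((n : ℝ≥0∞) + 1)⁻¹ ≤ ENNReal.ofReal (g x)} := by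
            refine measure_mono fun x hx => ?_
            rw [Set.mem_ofPred_eq, ← hε]
            exact ENNReal.ofReal_le_ofReal hx.2.le
        _ = (n + 1) * (((n : ℝ≥0∞) + 1)⁻¹ *
              cosetMeasure η q {x | ((n : ℝ≥0∞) + 1)⁻¹ ≤ ENNReal.ofReal (g x)}) := by
            rw [← mul_assoc, ENNReal.mul_inv_cancel (by simp) (by simp), one_mul]
        _ ≤ (n + 1) * 1 := by gcongr
        _ = n + 1 := mul_one _
    · rw [Set.indicator_of_notMem hq, nonpos_iff_eq_zero, ← nonpos_iff_eq_zero]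
      have h0 := ae_cosetMeasure_mk_eq η hH q
      refine (measure_mono_null (fun x hx => ?_) h0).le
      intro h
      exact hq (h ▸ hx.1)
  · rintro x ⟨hxS, hxg⟩
    obtain ⟨m, hm⟩ := Set.mem_iUnion.1 (hV hxS)
    have hgx : 0 < g x := lt_of_le_of_ne (hg0 x) (Ne.symm hxg)
    obtain ⟨k, hk⟩ := exists_nat_one_div_lt hgx
    -- One index serves both conditions: `V n` increases with `n`, while the threshold `1/(n+1)`
    -- decreases.
    refine Set.mem_iUnion.2 ⟨max m k, hVm (le_max_left _ _) hm, lt_of_le_of_lt ?_ hk⟩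
    rw [one_div]
    gcongr
    exact le_max_right _ _

/-- Weil's formula for the product of a function on `G ⧸ H` with a function on `G`. -/
theorem lintegral_comp_mk_mul [ν.OuterRegular] (hH : IsClosed (H : Set G)) (hc : c ≠ 0)
    (hW : ∀ U : Set G, IsOpen U → μ U = c * ∫⁻ q, cosetMeasure η q U ∂ν)
    (hg : Continuous g) (hg0 : ∀ x, 0 ≤ g x)
    (hg1 : ∀ q, ∫⁻ y, ENNReal.ofReal (g y) ∂cosetMeasure η q = 1)
    {φ : G ⧸ H → ℝ≥0∞} (hφ : Measurable φ) (hfin : ∫⁻ q, φ q ∂ν ≠ ∞)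
    {k : G → ℝ≥0∞} (hk : Measurable k) (hkg : ∀ x, g x = 0 → k x = 0) :
    ∫⁻ x, φ (x : G ⧸ H) * k x ∂μ = c * ∫⁻ q, φ q * ∫⁻ y, k y ∂cosetMeasure η q ∂ν := by
  have hm : Measurable ((↑) : G → G ⧸ H) := QuotientGroup.continuous_mk.measurable
  rw [(lintegral_eq_mul_lintegral_cosetMeasure_of_support hH hc hW
    (F := fun x => φ (x : G ⧸ H) * k x) ((hφ.comp hm).mul hk).aemeasurable ?_).2]
  · congr 1
    refine lintegral_congr fun q => ?_
    rw [← lintegral_const_mul _ hk]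
    refine lintegral_congr_ae ?_
    filter_upwards [ae_cosetMeasure_mk_eq η hH q] with y hy
    simp [hy]
  · obtain ⟨U, hUo, hUf, hU⟩ := isOpenSigmaFinite_preimage_inter_support hH hW hg hg0 hg1
      (isOpenSigmaFinite_support hφ.aemeasurable hfin)
    refine ⟨U, hUo, hUf, subset_trans (fun x hx => ?_) hU⟩
    have hx' : φ (x : G ⧸ H) * k x ≠ 0 := hx
    exact ⟨left_ne_zero_of_mul hx', fun h => right_ne_zero_of_mul hx' (hkg x h)⟩

/-- Null sets are pulled back only where `g ≠ 0`, which suffices because `Sφ` vanishes elsewhere. -/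
theorem ae_comp_mk_of_ae [ν.OuterRegular] (hH : IsClosed (H : Set G)) (hc : c ≠ 0)
    (hW : ∀ U : Set G, IsOpen U → μ U = c * ∫⁻ q, cosetMeasure η q U ∂ν)
    (hg : Continuous g) (hg0 : ∀ x, 0 ≤ g x)
    (hg1 : ∀ q, ∫⁻ y, ENNReal.ofReal (g y) ∂cosetMeasure η q = 1)
    {p : G ⧸ H → Prop} (hp : ∀ᵐ q ∂ν, p q) : ∀ᵐ x : G ∂μ, g x ≠ 0 → p (x : G ⧸ H) := by
  let N := toMeasurable ν {q | ¬ p q}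
  have hN : MeasurableSet N := measurableSet_toMeasurable _ _
  have hN0 : ν N = 0 := by rw [measure_toMeasurable]; exact hp
  have hφ : Measurable (N.indicator (1 : G ⧸ H → ℝ≥0∞)) := measurable_const.indicator hN
  have hm : Measurable ((↑) : G → G ⧸ H) := QuotientGroup.continuous_mk.measurable
  have hgm := hg.measurable.ennreal_ofReal
  have h0 : ∫⁻ q, N.indicator 1 q ∂ν = 0 := by rw [lintegral_indicator_one hN, hN0]
  have key := lintegral_comp_mk_mul hH hc hW hg hg0 hg1 hφ (by simp [h0])
    hgm (fun x hx => by simp [hx])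
  simp only [hg1, mul_one, h0, mul_zero] at key
  rw [lintegral_eq_zero_iff (f := fun x : G => N.indicator (1 : G ⧸ H → ℝ≥0∞) (x : G ⧸ H) *
    ENNReal.ofReal (g x)) ((hφ.comp hm).mul hgm)] at key
  filter_upwards [key] with x hx hgx
  by_contra hpx
  have hxN : (x : G ⧸ H) ∈ N := subset_toMeasurable _ _ hpx
  have : ENNReal.ofReal (g x) = 0 := by simpa [hxN] using hx
  exact hgx (le_antisymm (ENNReal.ofReal_eq_zero.1 this) (hg0 x))

-- A Bochner integral equal to `1` cannot be the default value `0` of a non-integrable function.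
omit [LocallyCompactSpace G] [H.Normal] [η.Regular] [MeasurableSpace (G ⧸ H)]
  [BorelSpace (G ⧸ H)] in
theorem IsWeightedBruhat.integrable_cosetMeasure (hH : IsClosed (H : Set G))
    (hg : IsWeightedBruhat η ω g) (q : G ⧸ H) : Integrable g (cosetMeasure η q) := by
  induction q using QuotientGroup.induction_on with
  | H x =>
    rw [integrable_cosetMeasure_mk_iff η hH]
    by_contra h
    exact one_ne_zero ((hg.integral_eq_one x).symm.trans (integral_undef h))

omit [LocallyCompactSpace G] [H.Normal] [η.Regular] [MeasurableSpace (G ⧸ H)]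
  [BorelSpace (G ⧸ H)] in
theorem IsWeightedBruhat.lintegral_cosetMeasure (hH : IsClosed (H : Set G))
    (hg : IsWeightedBruhat η ω g) (q : G ⧸ H) :
    ∫⁻ y, ENNReal.ofReal (g y) ∂cosetMeasure η q = 1 := by
  rw [← ofReal_integral_eq_lintegral_ofReal (hg.integrable_cosetMeasure hH q)
    (Filter.Eventually.of_forall hg.nonneg)]
  induction q using QuotientGroup.induction_on with
  | H x => rw [integral_cosetMeasure_mk η hH, hg.integral_eq_one, ENNReal.ofReal_one]

omit [LocallyCompactSpace G] [H.Normal] [η.Regular] [MeasurableSpace (G ⧸ H)]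
  [BorelSpace (G ⧸ H)] in
theorem IsWeightedBruhat.exists_lintegral_mul_cosetMeasure_le (hH : IsClosed (H : Set G))
    (hpos : ∀ x, 0 < ω x) (hg : IsWeightedBruhat η ω g) :
    ∃ C : NNReal, ∀ q : G ⧸ H, ∫⁻ y, ENNReal.ofReal (g y * ω y) ∂cosetMeasure η q ≤
      C * ENNReal.ofReal (quotientWeight H ω q) := by
  obtain ⟨C, hC, h⟩ := hg.integral_mul_le
  refine ⟨C.toNNReal, fun q => ?_⟩
  induction q using QuotientGroup.induction_on with
  | H x =>
    rw [lintegral_cosetMeasure_mk η hH, ← ofReal_integral_eq_lintegral_ofReal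
      (hg.integrable_mul x) (Filter.Eventually.of_forall fun h =>
        mul_nonneg (hg.nonneg _) (hpos _).le)]
    change _ ≤ ENNReal.ofReal C * _
    rw [← ENNReal.ofReal_mul hC.le]
    exact ENNReal.ofReal_le_ofReal (h x)

/-- A weighted Bruhat function gives a bounded operator from `L¹(G ⧸ H, ω̂)` to `L¹(G, ω)`. -/
theorem IsWeightedBruhat.exists_section [ν.OuterRegular] (hH : IsClosed (H : Set G)) (hc : c ≠ 0)
    (hW : ∀ U : Set G, IsOpen U → μ U = c * ∫⁻ q, cosetMeasure η q U ∂ν)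
    (hω : Continuous ω) {δ : ℝ} (hδ : 0 < δ) (hδω : ∀ x, δ ≤ ω x)
    (hg : IsWeightedBruhat η ω g) :
    ∃ S : WeightedL1 ν (quotientWeight H ω) →L[ℂ] WeightedL1 μ ω,
      ∀ (φ : G ⧸ H → ℂ) (hφ : MemLp φ 1 (weightedMeasure ν (quotientWeight H ω))),
        S (hφ.toLp φ) =ᵐ[μ] fun x => φ (x : G ⧸ H) * (g x : ℂ) := by
  have hpos : ∀ x, 0 < ω x := fun x => hδ.trans_le (hδω x)
  have hδω' := le_quotientWeight_of_forall (H := H) hδω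
  have hpos' : ∀ q, 0 < quotientWeight H ω q := fun q => hδ.trans_le (hδω' q)
  have hmω : Measurable ω := hω.measurable
  have hmω' : Measurable (quotientWeight H ω) :=
    (upperSemicontinuous_quotientWeight hω hpos).measurable
  have haeG := ae_weightedMeasure_eq (μ := μ) hmω hpos
  have haeQ := ae_weightedMeasure_eq (μ := ν) hmω' hpos'
  have hm : Measurable ((↑) : G → G ⧸ H) := QuotientGroup.continuous_mk.measurable
  have hg1 := hg.lintegral_cosetMeasure hH
  have hgm := hg.continuous.measurable
  obtain ⟨C, hC⟩ := hg.exists_lintegral_mul_cosetMeasure_le hH hpos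
  have hnull : ∀ φ ψ : G ⧸ H → ℂ, φ =ᵐ[ν] ψ →
      (fun x : G => φ (x : G ⧸ H) * (g x : ℂ)) =ᵐ[μ] fun x => ψ (x : G ⧸ H) * (g x : ℂ) := by
    intro φ ψ h
    filter_upwards [ae_comp_mk_of_ae hH hc hW hg.continuous hg.nonneg hg1 h] with x hx
    by_cases hgx : g x = 0
    · simp [hgx]
    · rw [hx hgx]
  have hS := exists_continuousLinearMap_of_representatives
    (μ := weightedMeasure ν (quotientWeight H ω)) (ν := weightedMeasure μ ω)
    -- The norm bound combines `c` from Weil's formula with the Bruhat constant `C`.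
    (fun φ x => φ (x : G ⧸ H) * (g x : ℂ)) (c * C) ?_ ?_ ?_ ?_ ?_
  · obtain ⟨S, hS⟩ := hS
    refine ⟨S, fun φ hφ => ?_⟩
    have := hS φ hφ
    rwa [Filter.EventuallyEq, haeG] at this
  · intro φ hφ
    have hφ1 := (aestronglyMeasurable_weightedMeasure_iff hmω' hpos').1 hφ.1
    rw [aestronglyMeasurable_weightedMeasure_iff hmω hpos]
    refine AEStronglyMeasurable.congr (StronglyMeasurable.aestronglyMeasurable ?_)
      (hnull _ _ hφ1.ae_eq_mk).symm
    exact (hφ1.stronglyMeasurable_mk.comp_measurable hm).mul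
      (Complex.measurable_ofReal.comp hgm).stronglyMeasurable
  · intro φ hφ
    have hφ1 := (aestronglyMeasurable_weightedMeasure_iff hmω' hpos').1 hφ.1
    have hψ := hφ1.stronglyMeasurable_mk
    have hint := (integrable_of_memLp_weightedMeasure hmω' hδ hδω' hφ).congr hφ1.ae_eq_mk
    set ψ := hφ1.mk φ
    rw [eLpNorm_one_weightedMeasure hmω', eLpNorm_one_weightedMeasure hmω]
    calc ∫⁻ x, ENNReal.ofReal (ω x) * ‖φ (x : G ⧸ H) * (g x : ℂ)‖ₑ ∂μ
        = ∫⁻ x : G, ‖ψ (x : G ⧸ H)‖ₑ * ENNReal.ofReal (g x * ω x) ∂μ := by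
          refine lintegral_congr_ae ?_
          filter_upwards [hnull _ _ hφ1.ae_eq_mk] with x hx
          have hgx : ‖(g x : ℂ)‖ₑ = ENNReal.ofReal (g x) := by
            rw [← ofReal_norm, Complex.norm_of_nonneg (hg.nonneg x)]
          rw [hx, enorm_mul, hgx, ENNReal.ofReal_mul (hg.nonneg x)]
          ring
      _ = c * ∫⁻ q, ‖ψ q‖ₑ * ∫⁻ y, ENNReal.ofReal (g y * ω y) ∂cosetMeasure η q ∂ν :=
          lintegral_comp_mk_mul hH hc hW hg.continuous hg.nonneg hg1 hψ.enorm hint.2.ne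
            (hgm.mul hmω).ennreal_ofReal fun x hx => by simp [hx]
      _ ≤ c * ∫⁻ q, C * (ENNReal.ofReal (quotientWeight H ω q) * ‖ψ q‖ₑ) ∂ν := by
          refine mul_le_mul_right (lintegral_mono fun q => ?_) _
          calc ‖ψ q‖ₑ * ∫⁻ y, ENNReal.ofReal (g y * ω y) ∂cosetMeasure η q
              ≤ ‖ψ q‖ₑ * (C * ENNReal.ofReal (quotientWeight H ω q)) := by gcongr; exact hC q
            _ = C * (ENNReal.ofReal (quotientWeight H ω q) * ‖ψ q‖ₑ) := by ring
      _ = ↑(c * C) * ∫⁻ q, ENNReal.ofReal (quotientWeight H ω q) * ‖φ q‖ₑ ∂ν := by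
          rw [lintegral_const_mul' _ _ ENNReal.coe_ne_top, ← mul_assoc, ENNReal.coe_mul]
          congr 1
          refine lintegral_congr_ae ?_
          filter_upwards [hφ1.ae_eq_mk] with q hq
          rw [hq]
  · intro φ ψ h
    rw [Filter.EventuallyEq, haeQ] at h
    rw [Filter.EventuallyEq, haeG]
    exact hnull φ ψ h
  · intro φ ψ _ _
    exact Filter.Eventually.of_forall fun x => add_mul _ _ _
  · intro a φ
    exact Filter.Eventually.of_forall fun x => mul_assoc _ _ _

omit [LocallyCompactSpace G] [H.Normal] [η.Regular] in
/-- The operators `T` and `S` of coset integration and of multiplication with a weighted Bruhat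
function satisfy `T ∘ S = id`. -/
theorem IsWeightedBruhat.comp_section_eq_id (hH : IsClosed (H : Set G))
    (hω : Continuous ω) (hpos : ∀ x, 0 < ω x) (hpos' : ∀ q, 0 < quotientWeight H ω q)
    (hg : IsWeightedBruhat η ω g)
    {T : WeightedL1 μ ω →L[ℂ] WeightedL1 ν (quotientWeight H ω)}
    (hT : ∀ (f : G → ℂ) (hf : MemLp f 1 (weightedMeasure μ ω)),
      T (hf.toLp f) =ᵐ[ν] cosetIntegral η f)
    {S : WeightedL1 ν (quotientWeight H ω) →L[ℂ] WeightedL1 μ ω}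
    (hS : ∀ (φ : G ⧸ H → ℂ) (hφ : MemLp φ 1 (weightedMeasure ν (quotientWeight H ω))),
      S (hφ.toLp φ) =ᵐ[μ] fun x => φ (x : G ⧸ H) * (g x : ℂ))
    (φ : WeightedL1 ν (quotientWeight H ω)) : T (S φ) = φ := by
  have haeG := ae_weightedMeasure_eq (μ := μ) hω.measurable hpos
  have haeQ := ae_weightedMeasure_eq (μ := ν)
    (upperSemicontinuous_quotientWeight (H := H) hω hpos).measurable hpos'
  have h1 : S φ =ᵐ[weightedMeasure μ ω] fun x : G => φ (x : G ⧸ H) * (g x : ℂ) := by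
    have := hS φ (Lp.memLp φ)
    rw [Lp.toLp_coeFn] at this
    rwa [Filter.EventuallyEq, haeG]
  have hmem := (memLp_congr_ae h1).1 (Lp.memLp (S φ))
  have h2 : S φ = hmem.toLp _ := Lp.ext (h1.trans hmem.coeFn_toLp.symm)
  have h3 := hT _ hmem
  rw [← h2] at h3
  refine Lp.ext ?_
  rw [Filter.EventuallyEq, haeQ]
  filter_upwards [h3] with q hq
  rw [hq, cosetIntegral_eq_integral_cosetMeasure η hH]
  have h4 : ∫ y : G, φ (y : G ⧸ H) * (g y : ℂ) ∂cosetMeasure η q =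
      ∫ y : G, φ q * (g y : ℂ) ∂cosetMeasure η q := by
    refine integral_congr_ae ?_
    filter_upwards [ae_cosetMeasure_mk_eq η hH q] with y hy
    rw [hy]
  rw [h4, integral_const_mul, integral_complex_ofReal]
  induction q using QuotientGroup.induction_on with
  | H x => rw [integral_cosetMeasure_mk η hH, hg.integral_eq_one]; simp

end

/-! ### Paracompactness of locally compact groups -/

/-- The fibres are open and disjoint, so locally finite refinements chosen on each of them unite to
one on `X`. -/
theorem ParacompactSpace.of_continuous_of_discreteTopology {X ι : Type*} [TopologicalSpace X]
    [TopologicalSpace ι] [DiscreteTopology ι] {p : X → ι} (hp : Continuous p)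
    (hpar : ∀ i, ParacompactSpace (p ⁻¹' {i})) : ParacompactSpace X where
  locallyFinite_refinement α s ho hu := by
    have hopen : ∀ i, IsOpen (p ⁻¹' {i}) := fun i => (isOpen_discrete {i}).preimage hp
    choose v hvo hvc hvf hvs using fun i => precise_refinement
      (fun a => ((↑) : p ⁻¹' {i} → X) ⁻¹' s a) (fun a => (ho a).preimage continuous_subtype_val)
      (by rw [← Set.preimage_iUnion, hu, Set.preimage_univ])
    refine ⟨α, fun a => ⋃ i, ((↑) : p ⁻¹' {i} → X) '' v i a, ?_, ?_, ?_, ?_⟩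
    · exact fun a => isOpen_iUnion fun i => (hopen i).isOpenMap_subtype_val _ (hvo i a)
    · refine Set.iUnion_eq_univ_iff.2 fun x => ?_
      obtain ⟨a, ha⟩ := Set.iUnion_eq_univ_iff.1 (hvc (p x)) ⟨x, rfl⟩
      exact ⟨a, Set.mem_iUnion.2 ⟨p x, ⟨x, rfl⟩, ha, rfl⟩⟩
    · intro x
      obtain ⟨t, ht, hfin⟩ := hvf (p x) ⟨x, rfl⟩
      refine ⟨(↑) '' t, (hopen (p x)).isOpenMap_subtype_val.image_mem_nhds ht, hfin.subset ?_⟩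
      rintro a ⟨-, hy, ⟨y, hyt, rfl⟩⟩
      obtain ⟨i, y', hy', hyy'⟩ := Set.mem_iUnion.1 hy
      have hi : i = p x := by
        rw [← show p y' = i from y'.2, hyy']; exact y.2
      subst hi
      exact ⟨y, Subtype.ext hyy' ▸ hy', hyt⟩
    · refine fun a => ⟨a, Set.iUnion_subset fun i => ?_⟩
      rintro - ⟨y, hy, rfl⟩
      exact hvs i a hy

-- The subgroup generated by a compact neighbourhood of `1`: the union of the powers of its
-- symmetrisation `K'`.
open scoped Pointwise in
theorem exists_isOpen_isSigmaCompact_subgroup (Q : Type*) [Group Q] [TopologicalSpace Q]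
    [IsTopologicalGroup Q] [LocallyCompactSpace Q] :
    ∃ L : Subgroup Q, IsOpen (L : Set Q) ∧ IsSigmaCompact (L : Set Q) := by
  obtain ⟨K, hK, hK1⟩ := exists_compact_mem_nhds (1 : Q)
  let K' := K ∪ K⁻¹
  have hK' : IsCompact K' := hK.union hK.inv
  have hinv : K'⁻¹ = K' := by simp [K', Set.union_comm]
  have hpow : ∀ n : ℕ, IsCompact (K' ^ n) := by
    intro n
    induction n with
    | zero => rw [pow_zero]; exact isCompact_singleton
    | succ n ih => rw [pow_succ]; exact ih.mul hK'
  let L : Subgroup Q :=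
    { carrier := ⋃ n : ℕ, K' ^ n
      one_mem' := Set.mem_iUnion.2 ⟨0, by simp⟩
      mul_mem' := by
        intro a b ha hb
        obtain ⟨m, hm⟩ := Set.mem_iUnion.1 ha
        obtain ⟨n, hn⟩ := Set.mem_iUnion.1 hb
        exact Set.mem_iUnion.2 ⟨m + n, by rw [pow_add]; exact Set.mul_mem_mul hm hn⟩
      inv_mem' := by
        intro a ha
        obtain ⟨m, hm⟩ := Set.mem_iUnion.1 ha
        refine Set.mem_iUnion.2 ⟨m, ?_⟩
        rw [← hinv, inv_pow]
        exact Set.inv_mem_inv.2 hm }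
  refine ⟨L, L.isOpen_of_mem_nhds (g := 1) (Filter.mem_of_superset hK1 fun x hx => ?_), ?_⟩
  · exact Set.mem_iUnion.2 ⟨1, by rw [pow_one]; exact Or.inl hx⟩
  · exact isSigmaCompact_iUnion_of_isCompact _ hpow

/-- A locally compact Hausdorff group is paracompact. -/
theorem paracompactSpace_of_locallyCompact_group (Q : Type*) [Group Q] [TopologicalSpace Q]
    [IsTopologicalGroup Q] [LocallyCompactSpace Q] [T2Space Q] : ParacompactSpace Q := by
  obtain ⟨L, hLo, hLs⟩ := exists_isOpen_isSigmaCompact_subgroup Q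
  have : DiscreteTopology (Q ⧸ L) := QuotientGroup.discreteTopology hLo
  have hcont : Continuous ((↑) : Q → Q ⧸ L) := QuotientGroup.continuous_mk
  refine ParacompactSpace.of_continuous_of_discreteTopology hcont fun i => ?_
  have hcl : IsClosed (((↑) : Q → Q ⧸ L) ⁻¹' {i}) := (isClosed_discrete {i}).preimage hcont
  have := hcl.isClosedEmbedding_subtypeVal.locallyCompactSpace
  -- Each fibre is a translate of `L`; being σ-compact, locally compact and Hausdorff, it is
  -- paracompact.
  have : SigmaCompactSpace (((↑) : Q → Q ⧸ L) ⁻¹' {i}) := by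
    rw [← isSigmaCompact_iff_sigmaCompactSpace]
    induction i using QuotientGroup.induction_on with
    | H a =>
      have : ((↑) : Q → Q ⧸ L) ⁻¹' {(a : Q ⧸ L)} = (a * ·) '' (L : Set Q) := by
        ext x
        rw [Set.mem_preimage, Set.mem_singleton_iff, eq_comm, QuotientGroup.eq]
        exact ⟨fun h => ⟨_, h, by simp⟩, by rintro ⟨l, hl, rfl⟩; simpa using hl⟩
      rw [this]
      exact hLs.image (continuous_const_mul a)
  infer_instance

/-! ### Existence of weighted Bruhat functions -/

noncomputable section

section Weight

variable {G : Type*} [Group G] [TopologicalSpace G] [IsTopologicalGroup G] {H : Subgroup G}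
  [H.Normal] {ω : G → ℝ}

-- Left multiplication by `x * z⁻¹` carries the coset of `z` into that of `x`.
omit [TopologicalSpace G] [IsTopologicalGroup G] in
theorem quotientWeight_le_mul (hpos : ∀ x, 0 < ω x) (hsub : ∀ x y, ω (x * y) ≤ ω x * ω y)
    (x z : G) :
    quotientWeight H ω (x : G ⧸ H) ≤ ω (x * z⁻¹) * quotientWeight H ω (z : G ⧸ H) := by
  rw [← div_le_iff₀' (hpos _)]
  refine le_quotientWeight z fun w hw => ?_
  rw [div_le_iff₀' (hpos _)]
  have : ((x * z⁻¹ * w : G) : G ⧸ H) = x := by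
    rw [QuotientGroup.mk_mul, hw, ← QuotientGroup.mk_mul, inv_mul_cancel_right]
  rw [← this]
  exact (quotientWeight_le hpos _).trans (hsub _ _)

/-- Every coset has a point with a neighbourhood on which `ω` is comparable with the induced
weight of the quotient; the constant does not depend on the coset. -/
theorem exists_mem_coset_eventually_le (hω : Continuous ω) (hpos : ∀ x, 0 < ω x)
    (hsub : ∀ x y, ω (x * y) ≤ ω x * ω y) {q : G ⧸ H} (hq : 0 < quotientWeight H ω q) :
    ∃ z : G, (z : G ⧸ H) = q ∧ ∃ W : Set G, IsOpen W ∧ z ∈ W ∧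
      ∀ y ∈ W, ω y ≤ 2 * (ω 1 + 1) * quotientWeight H ω (y : G ⧸ H) := by
  induction q using QuotientGroup.induction_on with
  | H x =>
    -- The factor `2` leaves room above the infimum for an actual point `z`. For `y` near `z`,
    -- continuity gives `ω (z * y⁻¹) < ω 1 + 1`, which compares `ω̂([z])` with `ω̂([y])`.
    obtain ⟨z, hz, hlt⟩ := exists_lt_of_quotientWeight_lt x (lt_two_mul_self hq)
    refine ⟨z, hz, {y | ω y < 2 * quotientWeight H ω (x : G ⧸ H)} ∩
      {y | ω (z * y⁻¹) < ω 1 + 1}, ?_, ⟨hlt, by simp⟩, fun y hy => ?_⟩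
    · exact (isOpen_lt hω continuous_const).inter
        (isOpen_lt (hω.comp (continuous_const.mul continuous_inv)) continuous_const)
    · have hy0 : 0 ≤ quotientWeight H ω (y : G ⧸ H) := le_quotientWeight y fun w _ => (hpos w).le
      have h1 := quotientWeight_le_mul (H := H) hpos hsub z y
      rw [hz] at h1
      have h2 := mul_le_mul_of_nonneg_right (le_of_lt hy.2) hy0
      have h3 : ω y < 2 * quotientWeight H ω (x : G ⧸ H) := hy.1
      linarith

end Weight

variable {G : Type*} [Group G] [TopologicalSpace G] [IsTopologicalGroup G]
  [T2Space G] [LocallyCompactSpace G] [MeasurableSpace G] [BorelSpace G] {H : Subgroup G}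
  [H.Normal] {η : Measure H} [η.IsHaarMeasure] {ω : G → ℝ}

theorem HasCompactSupport.comp_mul_coe {G : Type*} [Group G] [TopologicalSpace G]
    [IsTopologicalGroup G] {H : Subgroup G} (hH : IsClosed (H : Set G)) {f : G → ℝ}
    (hf : HasCompactSupport f) (x : G) : HasCompactSupport fun h : H => f (x * h) :=
  hf.comp_isClosedEmbedding (isClosedEmbedding_mul_coe hH x)

omit [T2Space G] [LocallyCompactSpace G] [H.Normal] in
theorem integral_cosetMeasure_mk_pos (hH : IsClosed (H : Set G)) {f : G → ℝ} (hf : Continuous f)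
    (hfc : HasCompactSupport f) (hf0 : ∀ x, 0 ≤ f x) {x : G} (hx : f x ≠ 0) :
    0 < ∫ y, f y ∂cosetMeasure η (x : G ⧸ H) := by
  rw [integral_cosetMeasure_mk η hH]
  have hcont : Continuous fun h : H => f (x * h) :=
    hf.comp (continuous_const.mul continuous_subtype_val)
  exact hcont.integral_pos_of_hasCompactSupport_nonneg_nonzero
    (hfc.comp_mul_coe hH x) (fun h => hf0 _) (x := 1) (by simpa using hx)

-- With bumps `f_q` in the good neighbourhoods, `F_q` their coset integrals and `ρ_q` a partition of
-- unity subordinate to `{F_q > 0}`, take `g = ∑ (ρ_q / F_q) f_q`. Each term has coset integral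
-- `ρ_q`, and `ω ≤ 2(ω(1) + 1) ω̂` wherever some `f_q` is nonzero.
omit [T2Space G] in
theorem exists_isWeightedBruhat (hH : IsClosed (H : Set G)) (hω : Continuous ω)
    (hsub : ∀ x y, ω (x * y) ≤ ω x * ω y) {δ : ℝ} (hδ : 0 < δ) (hδω : ∀ x, δ ≤ ω x) :
    ∃ g : G → ℝ, IsWeightedBruhat η ω g := by
  -- Lets instance search see that `G ⧸ H` is Hausdorff, as paracompactness requires.
  have : IsClosed (H : Set G) := hH
  have hpos : ∀ x, 0 < ω x := fun x => hδ.trans_le (hδω x)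
  have hpos' : ∀ q, 0 < quotientWeight H ω q := fun q =>
    hδ.trans_le (le_quotientWeight_of_forall hδω q)
  have hmk : Continuous ((↑) : G → G ⧸ H) := QuotientGroup.continuous_mk
  have : ParacompactSpace (G ⧸ H) := paracompactSpace_of_locallyCompact_group _
  choose z hz W hWo hzW hW using fun q : G ⧸ H =>
    exists_mem_coset_eventually_le hω hpos hsub (hpos' q)
  choose f hf using fun q : G ⧸ H =>
    UrysohnFunction.exists_eq_one isCompact_singleton (hWo q) (Set.singleton_subset_iff.2 (hzW q))
  let F : G ⧸ H → G ⧸ H → ℝ := fun q p => ∫ y, (f q).1 y ∂cosetMeasure η p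
  have hF : ∀ q, Continuous (F q) := fun q =>
    continuous_integral_cosetMeasure η hH (f q).1.continuous (f q).1.hasCompactSupport
  have hF0 : ∀ q, 0 < F q q := by
    intro q
    have h := integral_cosetMeasure_mk_pos (η := η) hH (f q).1.continuous
      (f q).1.hasCompactSupport (fun y => ((f q).2.1 y).1) (x := z q) (by simp [hf q])
    rwa [hz q] at h
  obtain ⟨ρ, hρ⟩ := PartitionOfUnity.exists_isSubordinate (isClosed_univ (X := G ⧸ H))
    (fun q => {p | 0 < F q p}) (fun q => isOpen_lt continuous_const (hF q))
    (fun q _ => Set.mem_iUnion.2 ⟨q, hF0 q⟩)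
  have hρF : ∀ q, Continuous fun p => ρ q p * (F q p)⁻¹ := by
    intro q
    -- Zeros of `F q` do no harm: the closed support of `ρ q` lies in `{F q > 0}`.
    refine continuous_of_tsupport fun p hp => ?_
    have hp' : 0 < F q p := hρ q (tsupport_mul_subset_left hp)
    exact (ρ q).continuous.continuousAt.mul ((hF q).continuousAt.inv₀ hp'.ne')
  let t : G ⧸ H → G → ℝ := fun q x => ρ q (x : G ⧸ H) * (F q (x : G ⧸ H))⁻¹ * (f q).1 x
  have ht0 : ∀ q x, 0 ≤ t q x := by
    intro q x
    refine mul_nonneg (mul_nonneg (ρ.nonneg q _) (inv_nonneg.2 ?_)) ((f q).2.1 x).1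
    exact integral_nonneg fun y => ((f q).2.1 y).1
  have htc : ∀ q, Continuous (t q) := fun q => ((hρF q).comp hmk).mul (f q).1.continuous
  let g : G → ℝ := fun x => ∑ᶠ q, t q x
  have hg_sum : ∀ x : G, g x = ∑ q ∈ ρ.finsupport (x : G ⧸ H), t q x := by
    intro x
    refine finsum_eq_sum_of_support_subset _ fun q hq => ?_
    rw [ρ.coe_finsupport]
    exact left_ne_zero_of_mul (left_ne_zero_of_mul hq)
  have hg0 : ∀ x, 0 ≤ g x := fun x => finsum_nonneg fun q => ht0 q x
  have hg_cont : Continuous g := by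
    refine continuous_finsum htc fun x => ?_
    obtain ⟨V, hV, hfin⟩ := ρ.locallyFinite (x : G ⧸ H)
    refine ⟨((↑) : G → G ⧸ H) ⁻¹' V, hmk.continuousAt hV, hfin.subset ?_⟩
    rintro q ⟨y, hy, hyV⟩
    exact ⟨y, left_ne_zero_of_mul (left_ne_zero_of_mul hy), hyV⟩
  have hgω : ∀ x : G, g x * ω x ≤ 2 * (ω 1 + 1) * quotientWeight H ω (x : G ⧸ H) * g x := by
    intro x
    rw [hg_sum, Finset.sum_mul, Finset.mul_sum]
    refine Finset.sum_le_sum fun q _ => ?_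
    rw [mul_comm]
    by_cases hx : x ∈ tsupport (f q).1
    · exact mul_le_mul_of_nonneg_right (hW q x ((f q).2.2 hx)) (ht0 q x)
    · simp [t, image_eq_zero_of_notMem_tsupport hx]
  have hcoe : ∀ (x : G) (h : H), ((x * h : G) : G ⧸ H) = x := fun x h => by simp
  have hg_coset : ∀ (x : G) (h : H), g (x * h) = ∑ q ∈ ρ.finsupport (x : G ⧸ H),
      ρ q (x : G ⧸ H) * (F q (x : G ⧸ H))⁻¹ * (f q).1 (x * h) := by
    intro x h
    rw [hg_sum, hcoe]
    simp only [t, hcoe]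
  have hf_int : ∀ q (x : G), Integrable (fun h : H => (f q).1 (x * h)) η := fun q x =>
    Continuous.integrable_of_hasCompactSupport
      ((f q).1.continuous.comp (continuous_const.mul continuous_subtype_val))
      ((f q).1.hasCompactSupport.comp_mul_coe hH x)
  have hg_int : ∀ x : G, Integrable (fun h : H => g (x * h)) η := by
    intro x
    simp only [hg_coset]
    exact integrable_finsetSum _ fun q _ => (hf_int q x).const_mul _
  have hg_one : ∀ x : G, ∫ h : H, g (x * h) ∂η = 1 := by
    intro x
    simp only [hg_coset]
    rw [integral_finsetSum _ fun q _ => (hf_int q x).const_mul _]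
    refine (Finset.sum_congr rfl fun q hq => ?_).trans
      (ρ.sum_finsupport (Set.mem_univ (x : G ⧸ H)))
    have hne : F q (x : G ⧸ H) ≠ 0 :=
      (hρ q (subset_tsupport _ ((ρ.mem_finsupport _).1 hq))).ne'
    rw [integral_const_mul, ← integral_cosetMeasure_mk η hH]
    exact inv_mul_cancel_right₀ hne _
  have hgω' : ∀ (x : G) (h : H), g (x * h) * ω (x * h) ≤
      2 * (ω 1 + 1) * quotientWeight H ω (x : G ⧸ H) * g (x * h) := fun x h => by
    simpa only [hcoe] using hgω (x * h)
  have hgω_int : ∀ x : G, Integrable (fun h : H => g (x * h) * ω (x * h)) η := by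
    intro x
    refine ((hg_int x).const_mul (2 * (ω 1 + 1) * quotientWeight H ω (x : G ⧸ H))).mono'
      ?_ (Filter.Eventually.of_forall fun h => ?_)
    · exact ((hg_cont.mul hω).comp
        (continuous_const.mul continuous_subtype_val)).measurable.aestronglyMeasurable
    · rw [Real.norm_of_nonneg (mul_nonneg (hg0 _) (hpos _).le)]
      exact hgω' x h
  refine ⟨g, hg_cont, hg0, hg_one, hgω_int, 2 * (ω 1 + 1), by linarith [hpos 1], fun x => ?_⟩
  calc ∫ h : H, g (x * h) * ω (x * h) ∂η
      ≤ ∫ h : H, 2 * (ω 1 + 1) * quotientWeight H ω (x : G ⧸ H) * g (x * h) ∂η :=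
        integral_mono (hgω_int x) ((hg_int x).const_mul _) (hgω' x)
    _ = 2 * (ω 1 + 1) * quotientWeight H ω (x : G ⧸ H) := by
        rw [integral_const_mul, hg_one, mul_one]

end

/-! ### The projections and the complemented kernel -/

theorem mainTheorem4 {G : Type*} [Group G] [TopologicalSpace G] [IsTopologicalGroup G]
    [T2Space G] [LocallyCompactSpace G] [MeasurableSpace G] [BorelSpace G]
    (H : Subgroup G) [H.Normal] (hH : IsClosed (H : Set G))
    [MeasurableSpace (G ⧸ H)] [BorelSpace (G ⧸ H)]
    (μ : Measure G) [μ.IsHaarMeasure] [μ.Regular]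
    (η : Measure H) [η.IsHaarMeasure] [η.Regular]
    (ν : Measure (G ⧸ H)) [ν.IsHaarMeasure] [ν.Regular]
    (ω : G → ℝ) (hω : IsWeight ω) (hωc : Continuous ω) (hω0 : ∃ δ > 0, ∀ x, δ ≤ ω x) :
    -- the homomorphism `T` of `L¹(G, ω)` into `L¹(G ⧸ H, ω̂)`, given by integration over cosets
    ∃ T : WeightedL1 μ ω →L[ℂ] WeightedL1 ν (quotientWeight H ω),
      (∀ (f : G → ℂ) (hf : MemLp f 1 (weightedMeasure μ ω)),
        (∀ᵐ q ∂ν, ∀ x : G, (x : G ⧸ H) = q → Integrable (fun h : H => f (x * h)) η) ∧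
        T (hf.toLp f) =ᵐ[ν] cosetIntegral η f) ∧
      -- weighted Bruhat functions exist
      (∃ g : G → ℝ, IsWeightedBruhat η ω g) ∧
      -- each of them gives a continuous projection `P` with kernel `J = ker T`
      (∀ g : G → ℝ, IsWeightedBruhat η ω g →
        ∃ P : WeightedL1 μ ω →L[ℂ] WeightedL1 μ ω,
          (∀ (f : G → ℂ) (hf : MemLp f 1 (weightedMeasure μ ω)),
            P (hf.toLp f) =ᵐ[μ] fun x => cosetIntegral η f (x : G ⧸ H) * (g x : ℂ)) ∧
          IsIdempotentElem P ∧
          LinearMap.ker (P : WeightedL1 μ ω →ₗ[ℂ] WeightedL1 μ ω) =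
            LinearMap.ker (T : WeightedL1 μ ω →ₗ[ℂ] WeightedL1 ν (quotientWeight H ω))) ∧
      -- so `J` is complemented
      (LinearMap.ker (T : WeightedL1 μ ω →ₗ[ℂ]
        WeightedL1 ν (quotientWeight H ω))).ClosedComplemented := by
  obtain ⟨δ, hδ, hδω⟩ := hω0
  have hpos' : ∀ q, 0 < quotientWeight H ω q := fun q =>
    hδ.trans_le (le_quotientWeight_of_forall hδω q)
  obtain ⟨c, hc, hW⟩ := exists_measure_eq_mul_lintegral_cosetMeasure η hH μ ν
  obtain ⟨T, hT⟩ := exists_cosetIntegral_continuousLinearMap hH hc hW hωc hδ hδω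
  have hproj : ∀ g : G → ℝ, IsWeightedBruhat η ω g →
      ∃ P : WeightedL1 μ ω →L[ℂ] WeightedL1 μ ω,
        (∀ (f : G → ℂ) (hf : MemLp f 1 (weightedMeasure μ ω)),
          P (hf.toLp f) =ᵐ[μ] fun x => cosetIntegral η f (x : G ⧸ H) * (g x : ℂ)) ∧
        IsIdempotentElem P ∧
        LinearMap.ker (P : WeightedL1 μ ω →ₗ[ℂ] WeightedL1 μ ω) =
          LinearMap.ker (T : WeightedL1 μ ω →ₗ[ℂ] WeightedL1 ν (quotientWeight H ω)) := by
    intro g hg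
    obtain ⟨S, hS⟩ := hg.exists_section hH hc hW hωc hδ hδω
    have hTS := hg.comp_section_eq_id hH hωc hω.pos hpos' (fun f hf => (hT f hf).2) hS
    refine ⟨S.comp T, fun f hf => ?_, ?_, ?_⟩
    · have h1 : T (hf.toLp f) =ᵐ[weightedMeasure ν (quotientWeight H ω)] cosetIntegral η f := by
        rw [Filter.EventuallyEq, ae_weightedMeasure_eq
          (upperSemicontinuous_quotientWeight hωc hω.pos).measurable hpos']
        exact (hT f hf).2
      have hmem := (memLp_congr_ae h1).1 (Lp.memLp _)
      have h2 : T (hf.toLp f) = hmem.toLp _ := Lp.ext (h1.trans hmem.coeFn_toLp.symm)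
      rw [ContinuousLinearMap.comp_apply, h2]
      exact hS _ hmem
    -- `TS = id` gives `STST = ST`; likewise `STf = 0` forces `Tf = TSTf = 0`.
    · ext1 f
      exact congrArg S (hTS (T f))
    · ext f
      simp only [LinearMap.mem_ker, ContinuousLinearMap.coe_coe, ContinuousLinearMap.comp_apply]
      refine ⟨fun h => ?_, fun h => by rw [h, map_zero]⟩
      rw [← hTS (T f), h, map_zero]
  have hex := exists_isWeightedBruhat (η := η) hH hωc hω.submul hδ hδω
  refine ⟨T, fun f hf => ⟨?_, (hT f hf).2⟩, hex, hproj, ?_⟩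
  · filter_upwards [(hT f hf).1] with q hq x hx
    rwa [← hx, integrable_cosetMeasure_mk_iff η hH] at hq
  · obtain ⟨g, hg⟩ := hex
    obtain ⟨P, -, hP, hker⟩ := hproj g hg
    rw [← hker]
    have hmem : ∀ f, (ContinuousLinearMap.id ℂ (WeightedL1 μ ω) - P) f ∈
        LinearMap.ker (P : WeightedL1 μ ω →ₗ[ℂ] WeightedL1 μ ω) := by
      intro f
      have h : P (P f) = P f := congrArg (fun A : _ →L[ℂ] _ => A f) hP
      simp [LinearMap.mem_ker, h]
    -- `id - P` has range in `ker P` and is the identity there.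
    refine ⟨(ContinuousLinearMap.id ℂ _ - P).codRestrict _ hmem, fun f => Subtype.ext ?_⟩
    have hf : P f = 0 := f.2
    simp [hf]
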